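/- Let $S(0)=0$ and, for $u>0$, let $S(u)$ be a random variable having the gamma distribution with shape $u$ and scale $1$, i.e. with density $y^{u-1}e^{-y}/\Gamma(u)$ on $(0,\infty)$. For $t>0$, $x\ge 0$ and $g:[0,\infty)\to\mathbb R$ such that the expectations below are finite, define \[ L_t g(x)=E\,g\!\left(\frac{S(tx)}{t}\right),\qquad L_t^{[2]}g(x)=2L_{2t}g(x)-L_tg(x), \] \[ M_t^{[2]}g(x)=(tx-[tx])\,L_t^{[2]}g\!\left(\frac{[tx]+1}{t}\right)+([tx]+1-tx)\,L_t^{[2]}g\!\left(\frac{[tx]}{t}\right), \] where $[\cdot]$ is the integer part, and let $\|f\|=\sup_{x\ge 0}|f(x)|$. Let $F_p$ be the distribution function of the gamma distribution with shape $p$ and scale $1$, i.e. with density $x^{p-1}e^{-x}/\Gamma(p)$ on $(0,\infty)$. Then for every real $p\ge 2$ the expectations $L_sF_p(x)$, $s>0$, $x\ge 0$, are well defined and, for every real $t>0$, \[ \bigl\|M_t^{[2]}F_p-F_p\bigr\|\le\left(\frac{17}{12}+\frac{27}{16e}\right)\frac1{t^2}. \] The constant does not depend on $p$, and $\frac{17}{12}+\frac{27}{16e}=2.0375$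 when rounded to four decimal places. -/

import Mathlib

open scoped ENNReal
open MeasureTheory ProbabilityTheory

noncomputable section

/-- The law of `S(u)`, `u ≥ 0`, where `S` is the gamma process: the point mass at `0` for `u = 0`,
and the gamma distribution with shape `u` and scale `1` for `u > 0`. -/
def gammaProcessLaw (u : ℝ) : Measure ℝ :=
  if 0 < u then gammaMeasure u 1 else Measure.dirac 0

/-- The gamma-type operator `L_t g(x) = E g(S(tx)/t)`. -/
def gammaOp (t : ℝ) (g : ℝ → ℝ) (x : ℝ) : ℝ :=
  ∫ y, g (y / t) ∂(gammaProcessLaw (t * x))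

/-- Richardson extrapolation `L_t^{[2]} g = 2 L_{2t} g - L_t g`. -/
def gammaOp2 (t : ℝ) (g : ℝ → ℝ) (x : ℝ) : ℝ :=
  2 * gammaOp (2 * t) g x - gammaOp t g x

/-- The linear interpolation `M_t^{[2]} g` of `L_t^{[2]} g` between the points `k/t`, `k ∈ ℕ`. -/
def gammaInterp2 (t : ℝ) (g : ℝ → ℝ) (x : ℝ) : ℝ :=
  (t * x - ⌊t * x⌋) * gammaOp2 t g ((⌊t * x⌋ + 1) / t)
    + (⌊t * x⌋ + 1 - t * x) * gammaOp2 t g (⌊t * x⌋ / t)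

/-- The distribution function of the gamma distribution with shape `p` and scale `1`. -/
def gammaDF (p : ℝ) (x : ℝ) : ℝ := cdf (gammaMeasure p 1) x

/-- The sup-norm `sup_{x ≥ 0} |f x|`, with value `∞` for unbounded functions. -/
def supNormNonneg (f : ℝ → ℝ) : ℝ≥0∞ := ⨆ x ∈ Set.Ici (0 : ℝ), ENNReal.ofReal |f x|

end

open Set Filter Topology

/-! The interpolant only sees `L_t^{[2]}` at the nodes `k/t`, where the laws involved are those of
`h S(k)` and `(h/2) S(2k)` with `h = 1/t`: gamma laws of integer shape and common mean `hk`. Put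
`E_N = E F(h 2^{-N} S(2^N k))`. The variance `h²k/2^N` tends to `0`, so `E_N → F(hk)`, and the
extrapolated values `R_N = 2E_{N+1} - E_N` have the same limit. Hence the error at a node is the
telescoping sum of `R_N - R_{N+1} = 3E_{N+1} - E_N - 2E_{N+2}`. If each term is at most `C
(h/2^N)²`, the error is at most `(4/3) C h²`.

The bound on one term comes from integration by parts, `E f(S(u+1)) = E f(S(u)) + E f'(S(u+1))`. It
shows that trading one unit of scale `h` for two units of scale `h/2` costs exactly `(h²/4) E f''`
at a law containing all three units. Thus `E_0 - E_1` and `2(E_1 - E_2)` are `h²/4` times sums of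
values of `E f''` at mixed laws with nearly equal means. Comparing these term by term with the same
trade applied to `f''` leaves `E f'''` and `E f''''`, which are controlled by `|f'''| ≤ c₃/y`,
`|f''''| ≤ c₄/y²` and negative moments of the mixed laws. These moments, of order `1/(hk)` and
`1/(hk)²`, compensate the number of terms, so `k` disappears: `C = (7c₄ + 13c₃)/96`.

For `f = F_p` with `p = q + 1`, a Stirling lower bound for `Γ` gives `c₃ = 4` and `c₄ = 10`
uniformly in `q ≥ 1`, so the nodes contribute `122/72`. Linear interpolation of `F_p` adds `1/4`,
since `|F_p''| ≤ 1`. The total `35/18 ≈ 1.944` lies below the required constant. -/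

/-! ### Integration by parts for the gamma law -/

theorem gammaPDF_one_of_pos {q y : ℝ} (hy : 0 < y) :
    gammaPDF q 1 y = ENNReal.ofReal (y ^ (q - 1) * Real.exp (-y) / Real.Gamma q) := by
  rw [gammaPDF_of_nonneg hy.le]
  congr 1
  rw [Real.one_rpow, one_mul]
  ring

theorem integral_gammaMeasure {q : ℝ} (hq : 0 < q) (f : ℝ → ℝ) :
    ∫ y, f y ∂(gammaMeasure q 1)
      = ∫ y in Ioi 0, y ^ (q - 1) * Real.exp (-y) / Real.Gamma q * f y := by
  have hm : Measurable (gammaPDF q 1) := (measurable_gammaPDFReal q 1).ennreal_ofReal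
  rw [gammaMeasure, integral_withDensity_eq_integral_toReal_smul hm
    (ae_of_all _ fun x => ENNReal.ofReal_lt_top)]
  rw [← setIntegral_eq_integral_of_forall_compl_eq_zero (s := Ici (0 : ℝ)),
    integral_Ici_eq_integral_Ioi]
  · refine setIntegral_congr_fun measurableSet_Ioi fun y hy => ?_
    have hy : 0 < y := hy
    have := Real.Gamma_pos_of_pos hq
    simp only [gammaPDF_one_of_pos hy, smul_eq_mul]
    rw [ENNReal.toReal_ofReal (by positivity)]
  · intro y hy
    rw [gammaPDF_of_neg (by simpa using hy)]
    simp

theorem hasDerivAt_rpow_mul_exp_neg {u y : ℝ} (hy : 0 < y) :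
    HasDerivAt (fun y => y ^ u * Real.exp (-y))
      (u * (y ^ (u - 1) * Real.exp (-y)) - y ^ u * Real.exp (-y)) y := by
  have h1 := Real.hasDerivAt_rpow_const (p := u) (Or.inl hy.ne')
  have h2 := (hasDerivAt_neg y).exp
  refine (h1.mul h2).congr_deriv ?_
  ring

theorem integrableOn_rpow_mul_exp_neg_mul_bounded {u C : ℝ} (hu : 0 < u) {f : ℝ → ℝ}
    (hf : Continuous f) (hC : ∀ y, |f y| ≤ C) :
    IntegrableOn (fun y => y ^ (u - 1) * Real.exp (-y) * f y) (Ioi 0) := by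
  have h := Real.GammaIntegral_convergent hu
  have h' : IntegrableOn (fun y => y ^ (u - 1) * Real.exp (-y)) (Ioi 0) :=
    h.congr_fun (fun y _ => mul_comm _ _) measurableSet_Ioi
  exact h'.mul_bdd (c := C) hf.aestronglyMeasurable (ae_of_all _ fun y => hC y)

/-- `f` and `f'` are bounded continuous functions and `f'` is the derivative of `f` on `(0, ∞)`. -/
structure IsBddDeriv (f f' : ℝ → ℝ) : Prop where
  cont : Continuous f
  bdd : ∃ C, ∀ y, |f y| ≤ C
  cont' : Continuous f'
  bdd' : ∃ C, ∀ y, |f' y| ≤ C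
  deriv : ∀ y, 0 < y → HasDerivAt f (f' y) y

theorem IsBddDeriv.comp_affine {f f' : ℝ → ℝ} (h : IsBddDeriv f f') {a b : ℝ} (ha : 0 < a)
    (hb : 0 ≤ b) : IsBddDeriv (fun y => f (a * y + b)) (fun y => a * f' (a * y + b)) where
  cont := h.cont.comp (by fun_prop)
  bdd := h.bdd.imp fun _ hC y => hC _
  cont' := continuous_const.mul (h.cont'.comp (by fun_prop))
  bdd' := by
    obtain ⟨C, hC⟩ := h.bdd'
    refine ⟨a * C, fun y => ?_⟩
    rw [abs_mul, abs_of_pos ha]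
    exact mul_le_mul_of_nonneg_left (hC _) ha.le
  deriv y hy := by
    have h1 : HasDerivAt (fun y => a * y + b) a y := by
      simpa using ((hasDerivAt_id y).const_mul a).add_const b
    have h2 := (h.deriv (a * y + b) (by positivity)).comp y h1
    refine h2.congr_deriv ?_
    ring

theorem tendsto_rpow_mul_exp_neg_mul_bounded {u C : ℝ} {f : ℝ → ℝ} (hC : ∀ y, |f y| ≤ C) :
    Tendsto (fun y => f y * (y ^ u * Real.exp (-y))) atTop (𝓝 0) := by
  have h := tendsto_rpow_mul_exp_neg_mul_atTop_nhds_zero u 1 one_pos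
  simp only [neg_mul, one_mul] at h
  exact bdd_le_mul_tendsto_zero' C (Eventually.of_forall hC) h

/-- Integrate the derivative of `f(y) y^u e^{-y}` over `(0, ∞)` and divide by `Γ(u+1) = uΓ(u)`. -/
theorem integral_gammaProcessLaw_add_one {f f' : ℝ → ℝ} (h : IsBddDeriv f f') {u : ℝ}
    (hu : 0 ≤ u) :
    ∫ y, f y ∂(gammaProcessLaw (u + 1))
      = ∫ y, f y ∂(gammaProcessLaw u) + ∫ y, f' y ∂(gammaProcessLaw (u + 1)) := by
  obtain ⟨C, hC⟩ := h.bdd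
  obtain ⟨C', hC'⟩ := h.bdd'
  have hu1 : 0 < u + 1 := by linarith
  have hG := Real.Gamma_pos_of_pos hu1
  have i1 := integrableOn_rpow_mul_exp_neg_mul_bounded hu1 h.cont hC
  have i2 := integrableOn_rpow_mul_exp_neg_mul_bounded hu1 h.cont' hC'
  simp only [add_sub_cancel_right] at i1 i2
  -- At `u = 0` the factor `u` removes the non-integrable `y⁻¹`.
  have i3 : IntegrableOn (fun y => u * (y ^ (u - 1) * Real.exp (-y) * f y)) (Ioi 0) := by
    rcases hu.eq_or_lt with rfl | hu'
    · simp
    · exact (integrableOn_rpow_mul_exp_neg_mul_bounded hu' h.cont hC).const_mul u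
  -- Since `0 ^ 0 = 1`, the boundary term equals `f 0` when `u = 0`; it then plays the role of the
  -- expectation under the point mass. For `u > 0` it vanishes.
  have key : ∫ y in Ioi 0, ((y ^ u * Real.exp (-y) * f' y
      + u * (y ^ (u - 1) * Real.exp (-y) * f y)) - y ^ u * Real.exp (-y) * f y)
      = 0 - f 0 * ((0 : ℝ) ^ u * Real.exp (-0)) := by
    refine integral_Ioi_of_hasDerivAt_of_tendsto (f := fun y => f y * (y ^ u * Real.exp (-y)))
      ?_ ?_ ((i2.add i3).sub i1) (tendsto_rpow_mul_exp_neg_mul_bounded hC)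
    · refine (h.cont.continuousAt.mul ((Real.continuousAt_rpow_const _ _ (Or.inr hu)).mul
        (by fun_prop))).continuousWithinAt
    · intro y hy
      refine ((h.deriv y hy).mul (hasDerivAt_rpow_mul_exp_neg (u := u) hy)).congr_deriv ?_
      ring
  have i23 : IntegrableOn (fun y => y ^ u * Real.exp (-y) * f' y
      + u * (y ^ (u - 1) * Real.exp (-y) * f y)) (Ioi 0) := i2.add i3
  rw [integral_sub i23 i1, integral_add i2 i3, integral_const_mul] at key
  have e1 : ∀ g : ℝ → ℝ, ∫ y, g y ∂(gammaProcessLaw (u + 1))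
      = (∫ y in Ioi 0, y ^ u * Real.exp (-y) * g y) / Real.Gamma (u + 1) := by
    intro g
    rw [gammaProcessLaw, if_pos hu1, integral_gammaMeasure hu1, ← integral_div]
    simp only [add_sub_cancel_right]
    congr 1
    ext y
    ring
  rw [e1, e1]
  rcases hu.eq_or_lt with rfl | hu'
  · simp [gammaProcessLaw] at key ⊢
    linarith
  · have e2 : ∫ y, f y ∂(gammaProcessLaw u)
        = u * (∫ y in Ioi 0, y ^ (u - 1) * Real.exp (-y) * f y) / Real.Gamma (u + 1) := by
      have hGu := Real.Gamma_pos_of_pos hu'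
      rw [gammaProcessLaw, if_pos hu', integral_gammaMeasure hu', Real.Gamma_add_one hu'.ne',
        mul_div_mul_left _ _ hu'.ne', ← integral_div]
      congr 1
      ext y
      ring
    rw [e2, ← add_div]
    congr 1
    rw [Real.zero_rpow hu'.ne'] at key
    linarith

/-! ### Support and Laplace transform; scaled gamma laws and their convolutions -/

instance isProbabilityMeasure_gammaProcessLaw (u : ℝ) :
    IsProbabilityMeasure (gammaProcessLaw u) := by
  unfold gammaProcessLaw
  split_ifs with h
  · exact isProbabilityMeasure_gammaMeasure h one_pos
  · infer_instance

theorem ae_nonneg_gammaProcessLaw (u : ℝ) : ∀ᵐ y ∂(gammaProcessLaw u), 0 ≤ y := by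
  unfold gammaProcessLaw
  split_ifs with h
  · rw [ae_iff, gammaMeasure]
    have : {a : ℝ | ¬ 0 ≤ a} = Iio 0 := by ext; simp
    rw [this, withDensity_apply _ measurableSet_Iio]
    exact lintegral_gammaPDF_of_nonpos le_rfl
  · simp

theorem lintegral_exp_neg_mul_gammaProcessLaw (n : ℕ) {s : ℝ} (hs : 0 ≤ s) :
    ∫⁻ y, ENNReal.ofReal (Real.exp (-(s * y))) ∂(gammaProcessLaw n)
      = ENNReal.ofReal (((1 + s) ^ n)⁻¹) := by
  unfold gammaProcessLaw
  split_ifs with h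
  · have hm : Measurable (gammaPDF n 1) := (measurable_gammaPDFReal n 1).ennreal_ofReal
    rw [gammaMeasure, lintegral_withDensity_eq_lintegral_mul _ hm (by fun_prop)]
    have : ∀ y, (gammaPDF n 1 * fun y => ENNReal.ofReal (Real.exp (-(s * y)))) y
        = ENNReal.ofReal (((1 + s) ^ n)⁻¹) * gammaPDF n (1 + s) y := by
      intro y
      rcases lt_or_ge y 0 with hy | hy
      · simp [gammaPDF_of_neg hy]
      · simp only [Pi.mul_apply]
        have := Real.Gamma_pos_of_pos h
        rw [gammaPDF_of_nonneg hy, gammaPDF_of_nonneg hy, ← ENNReal.ofReal_mul (by positivity),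
          ← ENNReal.ofReal_mul (by positivity), Real.one_rpow, Real.rpow_natCast (1 + s)]
        congr 1
        have e : Real.exp (-((1 + s) * y)) = Real.exp (-(1 * y)) * Real.exp (-(s * y)) := by
          rw [← Real.exp_add]; ring_nf
        rw [e]
        field_simp
    simp_rw [this]
    rw [lintegral_const_mul' _ _ ENNReal.ofReal_ne_top,
      lintegral_gammaPDF_eq_one h (by positivity), mul_one]
  · have : n = 0 := by simpa using h
    subst this
    rw [lintegral_dirac]
    simp

/-- The law of `a * S(n)`, where `S` is the gamma process. -/
noncomputable def scaledGammaLaw (n : ℕ) (a : ℝ) : Measure ℝ :=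
  (gammaProcessLaw n).map (a * ·)

instance isProbabilityMeasure_scaledGammaLaw (n : ℕ) (a : ℝ) :
    IsProbabilityMeasure (scaledGammaLaw n a) :=
  Measure.isProbabilityMeasure_map (by fun_prop)

theorem scaledGammaLaw_zero (a : ℝ) : scaledGammaLaw 0 a = Measure.dirac 0 := by
  rw [scaledGammaLaw, gammaProcessLaw, if_neg (by simp), Measure.map_dirac' (by fun_prop)]
  simp

theorem ae_nonneg_scaledGammaLaw (n : ℕ) {a : ℝ} (ha : 0 < a) :
    ∀ᵐ y ∂(scaledGammaLaw n a), 0 ≤ y := by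
  rw [scaledGammaLaw, ae_map_iff (by fun_prop) measurableSet_Ici]
  filter_upwards [ae_nonneg_gammaProcessLaw n] with y hy
  positivity

theorem integral_scaledGammaLaw (n : ℕ) {a : ℝ} (ha : 0 < a) (f : ℝ → ℝ) :
    ∫ y, f y ∂(scaledGammaLaw n a) = ∫ y, f (a * y) ∂(gammaProcessLaw n) :=
  (Homeomorph.mulLeft₀ a ha.ne').measurableEmbedding.integral_map _

theorem integral_scaledGammaLaw_succ {f f' : ℝ → ℝ} (h : IsBddDeriv f f') {a b : ℝ} (ha : 0 < a)
    (hb : 0 ≤ b) (n : ℕ) :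
    ∫ y, f (y + b) ∂(scaledGammaLaw (n + 1) a)
      = ∫ y, f (y + b) ∂(scaledGammaLaw n a)
        + a * ∫ y, f' (y + b) ∂(scaledGammaLaw (n + 1) a) := by
  rw [integral_scaledGammaLaw _ ha, integral_scaledGammaLaw _ ha, integral_scaledGammaLaw _ ha,
    ← integral_const_mul]
  have := integral_gammaProcessLaw_add_one (h.comp_affine ha hb) (u := n) n.cast_nonneg
  exact_mod_cast this

theorem integrable_of_continuous_bounded {f : ℝ → ℝ} (hf : Continuous f) {C : ℝ}
    (hC : ∀ y, |f y| ≤ C) (μ : Measure ℝ) [IsFiniteMeasure μ] : Integrable f μ :=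
  Integrable.of_bound hf.aestronglyMeasurable C (ae_of_all _ hC)

/-- Condition on the independent summand `b` with law `μ`. Nonnegativity of `b` keeps the argument
in the half-line where `f'` is the derivative of `f`. -/
theorem integral_scaledGammaLaw_succ_conv {f f' : ℝ → ℝ} (h : IsBddDeriv f f') {a : ℝ}
    (ha : 0 < a) (n : ℕ) (μ : Measure ℝ) [IsProbabilityMeasure μ] (hμ : ∀ᵐ y ∂μ, 0 ≤ y) :
    ∫ y, f y ∂(scaledGammaLaw (n + 1) a ∗ μ)
      = ∫ y, f y ∂(scaledGammaLaw n a ∗ μ)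
        + a * ∫ y, f' y ∂(scaledGammaLaw (n + 1) a ∗ μ) := by
  obtain ⟨C, hC⟩ := h.bdd
  obtain ⟨C', hC'⟩ := h.bdd'
  have key : ∀ (g : ℝ → ℝ) (D : ℝ), Continuous g → (∀ y, |g y| ≤ D) →
      ∀ (ν : Measure ℝ) [IsProbabilityMeasure ν],
      (∫ y, g y ∂(ν ∗ μ) = ∫ b, (∫ y, g (y + b) ∂ν) ∂μ) ∧
        Integrable (fun b => ∫ y, g (y + b) ∂ν) μ := by
    intro g D hg hD ν _
    have hi := integrable_of_continuous_bounded hg hD (μ ∗ ν)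
    rw [Measure.conv_comm ν μ, integral_conv hi]
    constructor
    · simp_rw [add_comm]
    · have h2 := hi
      rw [Measure.conv, integrable_map_measure hg.aestronglyMeasurable (by fun_prop)] at h2
      have h3 := h2.integral_prod_left
      refine h3.congr (ae_of_all _ fun b => ?_)
      simp only [Function.comp_apply, add_comm]
  obtain ⟨e1, -⟩ := key f C h.cont hC (scaledGammaLaw (n + 1) a)
  obtain ⟨e2, j2⟩ := key f C h.cont hC (scaledGammaLaw n a)
  obtain ⟨e3, j3⟩ := key f' C' h.cont' hC' (scaledGammaLaw (n + 1) a)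
  rw [e1, e2, e3, ← integral_const_mul, ← integral_add j2 (j3.const_mul a)]
  refine integral_congr_ae ?_
  filter_upwards [hμ] with b hb
  exact integral_scaledGammaLaw_succ h ha hb n

theorem ae_nonneg_conv {μ ν : Measure ℝ} [IsProbabilityMeasure μ] [IsProbabilityMeasure ν]
    (hμ : ∀ᵐ y ∂μ, 0 ≤ y) (hν : ∀ᵐ y ∂ν, 0 ≤ y) : ∀ᵐ y ∂(μ ∗ ν), 0 ≤ y := by
  rw [Measure.conv, ae_map_iff (by fun_prop) measurableSet_Ici]
  have h1 := Measure.quasiMeasurePreserving_fst (μ := μ) (ν := ν) |>.ae hμ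
  have h2 := Measure.quasiMeasurePreserving_snd (μ := μ) (ν := ν) |>.ae hν
  filter_upwards [h1, h2] with y hy1 hy2
  exact add_nonneg hy1 hy2

/-- The law of `h * S₁(i) + (h / 2) * S₂(j) + (h / 4) * S₃(l)` for independent gamma processes. -/
noncomputable def tripleGammaLaw (h : ℝ) (i j l : ℕ) : Measure ℝ :=
  scaledGammaLaw i h ∗ (scaledGammaLaw j (h / 2) ∗ scaledGammaLaw l (h / 4))

instance isProbabilityMeasure_tripleGammaLaw (h : ℝ) (i j l : ℕ) :
    IsProbabilityMeasure (tripleGammaLaw h i j l) := by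
  unfold tripleGammaLaw; infer_instance

theorem tripleGammaLaw_zero_zero (h : ℝ) (i : ℕ) :
    tripleGammaLaw h i 0 0 = scaledGammaLaw i h := by
  simp [tripleGammaLaw, scaledGammaLaw_zero]

theorem tripleGammaLaw_zero_mid (h : ℝ) (j : ℕ) :
    tripleGammaLaw h 0 j 0 = scaledGammaLaw j (h / 2) := by
  simp [tripleGammaLaw, scaledGammaLaw_zero]

theorem tripleGammaLaw_zero_last (h : ℝ) (l : ℕ) :
    tripleGammaLaw h 0 0 l = scaledGammaLaw l (h / 4) := by
  simp [tripleGammaLaw, scaledGammaLaw_zero]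

theorem ae_nonneg_tripleGammaLaw {h : ℝ} (hh : 0 < h) (i j l : ℕ) :
    ∀ᵐ y ∂(tripleGammaLaw h i j l), 0 ≤ y :=
  ae_nonneg_conv (ae_nonneg_scaledGammaLaw _ hh)
    (ae_nonneg_conv (ae_nonneg_scaledGammaLaw _ (by positivity))
      (ae_nonneg_scaledGammaLaw _ (by positivity)))

theorem integral_tripleGammaLaw_succ_left {f f' : ℝ → ℝ} (hf : IsBddDeriv f f') {h : ℝ}
    (hh : 0 < h) (i j l : ℕ) :
    ∫ y, f y ∂(tripleGammaLaw h (i + 1) j l)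
      = ∫ y, f y ∂(tripleGammaLaw h i j l) + h * ∫ y, f' y ∂(tripleGammaLaw h (i + 1) j l) :=
  integral_scaledGammaLaw_succ_conv hf hh i _
    (ae_nonneg_conv (ae_nonneg_scaledGammaLaw _ (by positivity))
      (ae_nonneg_scaledGammaLaw _ (by positivity)))

theorem integral_tripleGammaLaw_succ_mid {f f' : ℝ → ℝ} (hf : IsBddDeriv f f') {h : ℝ}
    (hh : 0 < h) (i j l : ℕ) :
    ∫ y, f y ∂(tripleGammaLaw h i (j + 1) l)
      = ∫ y, f y ∂(tripleGammaLaw h i j l)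
        + h / 2 * ∫ y, f' y ∂(tripleGammaLaw h i (j + 1) l) := by
  have e : ∀ j, tripleGammaLaw h i j l
      = scaledGammaLaw j (h / 2) ∗ (scaledGammaLaw i h ∗ scaledGammaLaw l (h / 4)) := by
    intro j
    rw [tripleGammaLaw, ← Measure.conv_assoc, ← Measure.conv_assoc,
      Measure.conv_comm (scaledGammaLaw i h)]
  rw [e, e]
  exact integral_scaledGammaLaw_succ_conv hf (by positivity) j _
    (ae_nonneg_conv (ae_nonneg_scaledGammaLaw _ hh)
      (ae_nonneg_scaledGammaLaw _ (by positivity)))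

theorem integral_tripleGammaLaw_succ_right {f f' : ℝ → ℝ} (hf : IsBddDeriv f f') {h : ℝ}
    (hh : 0 < h) (i j l : ℕ) :
    ∫ y, f y ∂(tripleGammaLaw h i j (l + 1))
      = ∫ y, f y ∂(tripleGammaLaw h i j l)
        + h / 4 * ∫ y, f' y ∂(tripleGammaLaw h i j (l + 1)) := by
  have e : ∀ l, tripleGammaLaw h i j l
      = scaledGammaLaw l (h / 4) ∗ (scaledGammaLaw i h ∗ scaledGammaLaw j (h / 2)) := by
    intro l
    rw [tripleGammaLaw, ← Measure.conv_assoc, Measure.conv_comm _ (scaledGammaLaw l (h / 4))]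
  rw [e, e]
  exact integral_scaledGammaLaw_succ_conv hf (by positivity) l _
    (ae_nonneg_conv (ae_nonneg_scaledGammaLaw _ hh)
      (ae_nonneg_scaledGammaLaw _ (by positivity)))

/-! ### Trading one unit for two units of half the scale -/

/-- Both laws have the same mean, so first-order terms cancel. On Laplace transforms this is
`1/(1+hs) - 1/(1+hs/2)² = (h²s²/4) / ((1+hs)(1+hs/2)²)`. The proof reaches the law with all three
units along two routes and compares. -/
theorem integral_tripleGammaLaw_left_sub_mid {f f' f'' : ℝ → ℝ} (hf : IsBddDeriv f f')
    (hf' : IsBddDeriv f' f'') {h : ℝ} (hh : 0 < h) (i j l : ℕ) :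
    ∫ y, f y ∂(tripleGammaLaw h (i + 1) j l) - ∫ y, f y ∂(tripleGammaLaw h i (j + 2) l)
      = h ^ 2 / 4 * ∫ y, f'' y ∂(tripleGammaLaw h (i + 1) (j + 2) l) := by
  have e1 := integral_tripleGammaLaw_succ_mid hf hh (i + 1) j l
  have e2 := integral_tripleGammaLaw_succ_mid hf hh (i + 1) (j + 1) l
  have e3 := integral_tripleGammaLaw_succ_mid hf' hh (i + 1) (j + 1) l
  have e4 := integral_tripleGammaLaw_succ_left hf hh i (j + 2) l
  linear_combination -e1 - e2 + e4 + (h / 2) * e3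

theorem integral_tripleGammaLaw_mid_sub_right {f f' f'' : ℝ → ℝ} (hf : IsBddDeriv f f')
    (hf' : IsBddDeriv f' f'') {h : ℝ} (hh : 0 < h) (i j l : ℕ) :
    ∫ y, f y ∂(tripleGammaLaw h i (j + 1) l) - ∫ y, f y ∂(tripleGammaLaw h i j (l + 2))
      = h ^ 2 / 16 * ∫ y, f'' y ∂(tripleGammaLaw h i (j + 1) (l + 2)) := by
  have e1 := integral_tripleGammaLaw_succ_right hf hh i (j + 1) l
  have e2 := integral_tripleGammaLaw_succ_right hf hh i (j + 1) (l + 1)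
  have e3 := integral_tripleGammaLaw_succ_right hf' hh i (j + 1) (l + 1)
  have e4 := integral_tripleGammaLaw_succ_mid hf hh i j (l + 2)
  linear_combination -e1 - e2 + e4 + (h / 4) * e3

theorem integral_tripleGammaLaw_left_sub_mid_sum {f f' f'' : ℝ → ℝ} (hf : IsBddDeriv f f')
    (hf' : IsBddDeriv f' f'') {h : ℝ} (hh : 0 < h) (i j l : ℕ) :
    ∫ y, f y ∂(tripleGammaLaw h i j l) - ∫ y, f y ∂(tripleGammaLaw h 0 (j + 2 * i) l)
      = h ^ 2 / 4 * ∑ m ∈ Finset.range i,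
          ∫ y, f'' y ∂(tripleGammaLaw h (m + 1) (j + 2 * (i - m)) l) := by
  induction i generalizing j with
  | zero => simp
  | succ i ih =>
    have h1 := integral_tripleGammaLaw_left_sub_mid hf hf' hh i j l
    have h2 := ih (j + 2)
    rw [Finset.sum_range_succ, mul_add (h ^ 2 / 4), show i + 1 - i = 1 by omega, mul_one, ← h1]
    have e : ∀ m ∈ Finset.range i, j + 2 * (i + 1 - m) = j + 2 + 2 * (i - m) := by
      intro m hm
      have := Finset.mem_range.1 hm
      omega
    rw [Finset.sum_congr rfl fun m hm => by rw [e m hm], ← h2,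
      show j + 2 * (i + 1) = j + 2 + 2 * i by ring]
    ring

theorem integral_tripleGammaLaw_mid_sub_right_sum {f f' f'' : ℝ → ℝ} (hf : IsBddDeriv f f')
    (hf' : IsBddDeriv f' f'') {h : ℝ} (hh : 0 < h) (i s n l : ℕ) :
    ∫ y, f y ∂(tripleGammaLaw h i (s + n) l) - ∫ y, f y ∂(tripleGammaLaw h i s (l + 2 * n))
      = h ^ 2 / 16 * ∑ m ∈ Finset.range n,
          ∫ y, f'' y ∂(tripleGammaLaw h i (s + m + 1) (l + 2 * (n - m))) := by
  induction n generalizing l with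
  | zero => simp
  | succ n ih =>
    have h1 := integral_tripleGammaLaw_mid_sub_right hf hf' hh i (s + n) l
    have h2 := ih (l + 2)
    rw [Finset.sum_range_succ, mul_add (h ^ 2 / 16), show n + 1 - n = 1 by omega, mul_one, ← h1]
    have e : ∀ m ∈ Finset.range n, l + 2 * (n + 1 - m) = l + 2 + 2 * (n - m) := by
      intro m hm
      have := Finset.mem_range.1 hm
      omega
    rw [Finset.sum_congr rfl fun m hm => by rw [e m hm], ← h2,
      show l + 2 * (n + 1) = l + 2 + 2 * n by ring, show s + (n + 1) = s + n + 1 by ring]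
    ring

/-! ### Negative moments of mixed laws via Laplace transforms -/

theorem lintegral_exp_neg_mul_scaledGammaLaw (n : ℕ) {a s : ℝ} (ha : 0 < a) (hs : 0 ≤ s) :
    ∫⁻ y, ENNReal.ofReal (Real.exp (-(s * y))) ∂(scaledGammaLaw n a)
      = ENNReal.ofReal (((1 + a * s) ^ n)⁻¹) := by
  rw [scaledGammaLaw, lintegral_map (by fun_prop) (by fun_prop),
    ← lintegral_exp_neg_mul_gammaProcessLaw n (by positivity)]
  refine lintegral_congr fun y => ?_
  congr 3
  ring

theorem lintegral_exp_neg_mul_conv (μ ν : Measure ℝ) [SFinite μ] [SFinite ν] (s : ℝ) :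
    ∫⁻ y, ENNReal.ofReal (Real.exp (-(s * y))) ∂(μ ∗ ν)
      = (∫⁻ y, ENNReal.ofReal (Real.exp (-(s * y))) ∂μ)
        * ∫⁻ y, ENNReal.ofReal (Real.exp (-(s * y))) ∂ν := by
  rw [Measure.lintegral_conv (by fun_prop), ← lintegral_mul_const _ (by fun_prop)]
  refine lintegral_congr fun x => ?_
  rw [← lintegral_const_mul _ (by fun_prop)]
  refine lintegral_congr fun y => ?_
  rw [← ENNReal.ofReal_mul (Real.exp_pos _).le, ← Real.exp_add]
  congr 2
  ring

/-- Bernoulli's inequality `(1+x)^θ ≤ 1 + θx`. It brings all three scales to the common base `1 +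
hs`, so that only the normalised mean `i + j/2 + l/4` matters. -/
theorem inv_pow_le_rpow_neg {x θ : ℝ} (hx : 0 ≤ x) (h0 : 0 ≤ θ) (h1 : θ ≤ 1) (n : ℕ) :
    ((1 + θ * x) ^ n)⁻¹ ≤ (1 + x) ^ (-(θ * n)) := by
  have hb := rpow_one_add_le_one_add_mul_self (s := x) (by linarith) h0 h1
  rw [Real.rpow_neg (by positivity), Real.rpow_mul (by positivity), Real.rpow_natCast]
  gcongr

theorem lintegral_exp_neg_mul_tripleGammaLaw_le {h s : ℝ} (hh : 0 < h) (hs : 0 ≤ s)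
    (i j l : ℕ) :
    ∫⁻ y, ENNReal.ofReal (Real.exp (-(s * y))) ∂(tripleGammaLaw h i j l)
      ≤ ENNReal.ofReal ((1 + h * s) ^ (-(i + j / 2 + l / 4 : ℝ))) := by
  have hx : 0 ≤ h * s := by positivity
  rw [tripleGammaLaw, lintegral_exp_neg_mul_conv, lintegral_exp_neg_mul_conv,
    lintegral_exp_neg_mul_scaledGammaLaw _ hh hs,
    lintegral_exp_neg_mul_scaledGammaLaw _ (by positivity) hs,
    lintegral_exp_neg_mul_scaledGammaLaw _ (by positivity) hs,
    ← ENNReal.ofReal_mul (by positivity), ← ENNReal.ofReal_mul (by positivity)]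
  refine ENNReal.ofReal_le_ofReal ?_
  have h1 := inv_pow_le_rpow_neg hx zero_le_one le_rfl i
  have h2 := inv_pow_le_rpow_neg hx (θ := 1 / 2) (by norm_num) (by norm_num) j
  have h3 := inv_pow_le_rpow_neg hx (θ := 1 / 4) (by norm_num) (by norm_num) l
  have e : (1 + h * s) ^ (-(i + j / 2 + l / 4 : ℝ)) = (1 + h * s) ^ (-(1 * (i : ℝ)))
      * ((1 + h * s) ^ (-(1 / 2 * (j : ℝ))) * (1 + h * s) ^ (-(1 / 4 * (l : ℝ)))) := by
    rw [← Real.rpow_add (by positivity), ← Real.rpow_add (by positivity)]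
    congr 1
    ring
  rw [e]
  have e2 : 1 + h / 2 * s = 1 + 1 / 2 * (h * s) := by ring
  have e3 : 1 + h / 4 * s = 1 + 1 / 4 * (h * s) := by ring
  rw [e2, e3]
  rw [one_mul] at h1
  gcongr

/-- Tonelli, for `|f|` dominated by the Laplace transform of a weight `w`. Working in `ℝ≥0∞` avoids
any integrability condition. -/
theorem ofReal_abs_integral_tripleGammaLaw_le {h : ℝ} (hh : 0 < h) (i j l : ℕ) {f w : ℝ → ℝ}
    (hw : Measurable w)
    (hf : ∀ y, 0 ≤ y → ENNReal.ofReal |f y|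
      ≤ ∫⁻ s in Ioi 0, ENNReal.ofReal (w s) * ENNReal.ofReal (Real.exp (-(s * y)))) :
    ENNReal.ofReal |∫ y, f y ∂(tripleGammaLaw h i j l)|
      ≤ ∫⁻ s in Ioi 0, ENNReal.ofReal (w s)
          * ENNReal.ofReal ((1 + h * s) ^ (-(i + j / 2 + l / 4 : ℝ))) := by
  have h1 := enorm_integral_le_lintegral_enorm (μ := tripleGammaLaw h i j l) f
  simp only [Real.enorm_eq_ofReal_abs] at h1
  refine h1.trans ?_
  calc ∫⁻ y, ENNReal.ofReal |f y| ∂(tripleGammaLaw h i j l)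
      ≤ ∫⁻ y, (∫⁻ s in Ioi 0, ENNReal.ofReal (w s) * ENNReal.ofReal (Real.exp (-(s * y))))
          ∂(tripleGammaLaw h i j l) := by
        refine lintegral_mono_ae ?_
        filter_upwards [ae_nonneg_tripleGammaLaw hh i j l] with y hy using hf y hy
    _ = ∫⁻ s in Ioi 0, ∫⁻ y, ENNReal.ofReal (w s) * ENNReal.ofReal (Real.exp (-(s * y)))
          ∂(tripleGammaLaw h i j l) := lintegral_lintegral_swap (by fun_prop)
    _ ≤ _ := by
        refine setLIntegral_mono' measurableSet_Ioi fun s hs => ?_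
        rw [lintegral_const_mul _ (by fun_prop)]
        gcongr
        exact lintegral_exp_neg_mul_tripleGammaLaw_le hh (le_of_lt hs) i j l

theorem lintegral_exp_neg_mul_Ioi {z : ℝ} (hz : 0 < z) :
    ∫⁻ s in Ioi 0, ENNReal.ofReal (Real.exp (-(s * z))) = ENNReal.ofReal (1 / z) := by
  have hi : IntegrableOn (fun s => Real.exp (-(s * z))) (Ioi 0) := by
    simpa [mul_comm] using exp_neg_integrableOn_Ioi 0 hz
  rw [← ofReal_integral_eq_lintegral_ofReal hi (ae_of_all _ fun s => (Real.exp_pos _).le)]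
  have := Real.integral_rpow_mul_exp_neg_mul_Ioi one_pos hz
  simp only [sub_self, Real.rpow_zero, one_mul, Real.rpow_one, Real.Gamma_one, mul_one] at this
  rw [← this]
  simp only [mul_comm]

theorem lintegral_mul_exp_neg_mul_Ioi {z : ℝ} (hz : 0 < z) :
    ∫⁻ s in Ioi 0, ENNReal.ofReal (s * Real.exp (-(s * z))) = ENNReal.ofReal (1 / z ^ 2) := by
  have := Real.integral_rpow_mul_exp_neg_mul_Ioi two_pos hz
  rw [show (2 : ℝ) - 1 = 1 by norm_num, Real.Gamma_two, mul_one, Real.rpow_two] at this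
  simp only [Real.rpow_one] at this
  have e : (1 / z) ^ 2 = 1 / z ^ 2 := by ring
  rw [← e, ← this, ofReal_integral_eq_lintegral_ofReal]
  · simp only [mul_comm]
  · by_contra hni
    rw [integral_undef hni] at this
    have : 0 < (1 / z) ^ 2 := by positivity
    linarith
  · refine (ae_restrict_iff' measurableSet_Ioi).2 (ae_of_all _ fun s (hs : 0 < s) => ?_)
    positivity

theorem hasDerivAt_one_add_mul_rpow {h s M : ℝ} (hh : 0 < h) (hs : 0 ≤ s) (hM : 1 < M) :
    HasDerivAt (fun s => -(1 + h * s) ^ (-(M - 1)) / (h * (M - 1))) ((1 + h * s) ^ (-M)) s := by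
  have h1 : HasDerivAt (fun s => 1 + h * s) h s := by
    simpa using ((hasDerivAt_id s).const_mul h).const_add 1
  have h2 := (h1.rpow_const (p := -(M - 1)) (Or.inl (by positivity))).neg.div_const (h * (M - 1))
  refine h2.congr_deriv ?_
  rw [show -(M - 1) - 1 = -M by ring]
  have : M - 1 ≠ 0 := by linarith
  field_simp

theorem tendsto_one_add_mul_rpow {h M : ℝ} (hh : 0 < h) (hM : 1 < M) :
    Tendsto (fun s => -(1 + h * s) ^ (-(M - 1)) / (h * (M - 1))) atTop (𝓝 0) := by
  have h1 : Tendsto (fun s => 1 + h * s) atTop atTop :=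
    tendsto_atTop_add_const_left _ _ (tendsto_id.const_mul_atTop hh)
  have h2 := ((tendsto_rpow_neg_atTop (y := M - 1) (by linarith)).comp h1).neg.div_const
    (h * (M - 1))
  simpa using h2

theorem lintegral_one_add_mul_rpow {h M : ℝ} (hh : 0 < h) (hM : 1 < M) :
    ∫⁻ s in Ioi 0, ENNReal.ofReal ((1 + h * s) ^ (-M)) = ENNReal.ofReal (1 / (h * (M - 1))) := by
  have hd : ∀ s ∈ Ici (0 : ℝ), HasDerivAt (fun s => -(1 + h * s) ^ (-(M - 1)) / (h * (M - 1)))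
      ((1 + h * s) ^ (-M)) s := fun s hs => hasDerivAt_one_add_mul_rpow hh hs hM
  have hp : ∀ s ∈ Ioi (0 : ℝ), 0 ≤ (1 + h * s) ^ (-M) := fun s (hs : 0 < s) => by positivity
  have hi := integrableOn_Ioi_deriv_of_nonneg' hd hp (tendsto_one_add_mul_rpow hh hM)
  have hv := integral_Ioi_of_hasDerivAt_of_tendsto' hd hi (tendsto_one_add_mul_rpow hh hM)
  rw [← ofReal_integral_eq_lintegral_ofReal hi ((ae_restrict_iff' measurableSet_Ioi).2
    (ae_of_all _ hp)), hv]
  simp [neg_div]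

theorem lintegral_mul_one_add_mul_rpow {h M : ℝ} (hh : 0 < h) (hM : 2 < M) :
    ∫⁻ s in Ioi 0, ENNReal.ofReal (s * (1 + h * s) ^ (-M))
      = ENNReal.ofReal (1 / (h ^ 2 * (M - 1) * (M - 2))) := by
  have hd : ∀ s ∈ Ici (0 : ℝ), HasDerivAt
      (fun s => (-(1 + h * s) ^ (-(M - 1 - 1)) / (h * (M - 1 - 1))
        - -(1 + h * s) ^ (-(M - 1)) / (h * (M - 1))) / h)
      (s * (1 + h * s) ^ (-M)) s := fun s (hs : 0 ≤ s) => by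
    refine (((hasDerivAt_one_add_mul_rpow hh hs (by linarith : 1 < M - 1)).sub
      (hasDerivAt_one_add_mul_rpow hh hs (by linarith : 1 < M))).div_const h).congr_deriv ?_
    have e : (1 + h * s) ^ (-(M - 1)) = (1 + h * s) ^ (-M) * (1 + h * s) := by
      rw [show -(M - 1) = -M + 1 by ring, Real.rpow_add (by positivity), Real.rpow_one]
    rw [e]
    field_simp
    ring
  have hp : ∀ s ∈ Ioi (0 : ℝ), 0 ≤ s * (1 + h * s) ^ (-M) :=
    fun s (hs : 0 < s) => by positivity
  have ht : Tendsto (fun s => (-(1 + h * s) ^ (-(M - 1 - 1)) / (h * (M - 1 - 1))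
        - -(1 + h * s) ^ (-(M - 1)) / (h * (M - 1))) / h) atTop (𝓝 0) := by
    simpa using ((tendsto_one_add_mul_rpow hh (by linarith : 1 < M - 1)).sub
      (tendsto_one_add_mul_rpow hh (by linarith : 1 < M))).div_const h
  have hi := integrableOn_Ioi_deriv_of_nonneg' hd hp ht
  have hv := integral_Ioi_of_hasDerivAt_of_tendsto' hd hi ht
  rw [← ofReal_integral_eq_lintegral_ofReal hi ((ae_restrict_iff' measurableSet_Ioi).2
    (ae_of_all _ hp)), hv]
  congr 1
  have h1 : M - 1 ≠ 0 := by linarith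
  have h2 : M - 2 ≠ 0 := by linarith
  have h3 : M - 1 - 1 ≠ 0 := by linarith
  have e : M - 1 - 1 = M - 2 := by ring
  simp only [mul_zero, add_zero, Real.one_rpow]
  rw [e]
  field_simp
  ring

/-- Write `1/(y+ε) = ∫ e^{-s(y+ε)} ds` and discard `e^{-sε}`: the resulting bound does not depend on
`ε`, which can therefore tend to `0` later. The version for the inverse square uses `∫ s e^{-sz} ds
= 1/z²`. -/
theorem abs_integral_tripleGammaLaw_le_of_inv {h ε c : ℝ} (hh : 0 < h) (hε : 0 < ε) (hc : 0 ≤ c)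
    (i j l : ℕ) {f : ℝ → ℝ} (hf : ∀ y, 0 ≤ y → |f y| ≤ c / (y + ε)) {m : ℝ} (hm : 0 < m)
    (hM : m + 1 ≤ i + j / 2 + l / 4) :
    |∫ y, f y ∂(tripleGammaLaw h i j l)| ≤ c / (h * m) := by
  set M : ℝ := i + j / 2 + l / 4 with hMdef
  have hb := ofReal_abs_integral_tripleGammaLaw_le hh i j l (f := f) (w := fun _ => c)
    measurable_const (fun y hy => by
      have hz : 0 < y + ε := by positivity
      calc ENNReal.ofReal |f y| ≤ ENNReal.ofReal (c * (1 / (y + ε))) := by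
            refine ENNReal.ofReal_le_ofReal ((hf y hy).trans_eq ?_)
            ring
        _ = ∫⁻ s in Ioi 0, ENNReal.ofReal c * ENNReal.ofReal (Real.exp (-(s * (y + ε)))) := by
            rw [ENNReal.ofReal_mul hc, ← lintegral_exp_neg_mul_Ioi hz,
              lintegral_const_mul _ (by fun_prop)]
        _ ≤ _ := by
            refine setLIntegral_mono' measurableSet_Ioi fun s (hs : 0 < s) => ?_
            gcongr
            linarith)
  rw [lintegral_const_mul _ (by fun_prop), ← hMdef,
    lintegral_one_add_mul_rpow hh (by linarith : 1 < M), ← ENNReal.ofReal_mul hc,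
    ENNReal.ofReal_le_ofReal_iff (mul_nonneg hc (one_div_nonneg.2
      (mul_nonneg hh.le (by linarith))))] at hb
  refine hb.trans ?_
  rw [mul_one_div]
  gcongr
  linarith

theorem abs_integral_tripleGammaLaw_le_of_inv_sq {h ε c : ℝ} (hh : 0 < h) (hε : 0 < ε)
    (hc : 0 ≤ c) (i j l : ℕ) {f : ℝ → ℝ} (hf : ∀ y, 0 ≤ y → |f y| ≤ c / (y + ε) ^ 2) {m : ℝ}
    (hm : 0 < m) (hM : m + 2 ≤ i + j / 2 + l / 4) :
    |∫ y, f y ∂(tripleGammaLaw h i j l)| ≤ c / (h ^ 2 * (m + 1) * m) := by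
  set M : ℝ := i + j / 2 + l / 4 with hMdef
  have hb := ofReal_abs_integral_tripleGammaLaw_le hh i j l (f := f) (w := fun s => c * s)
    (by fun_prop) (fun y hy => by
      have hz : 0 < y + ε := by positivity
      calc ENNReal.ofReal |f y| ≤ ENNReal.ofReal (c * (1 / (y + ε) ^ 2)) := by
            refine ENNReal.ofReal_le_ofReal ((hf y hy).trans_eq ?_)
            ring
        _ = ∫⁻ s in Ioi 0, ENNReal.ofReal c
              * ENNReal.ofReal (s * Real.exp (-(s * (y + ε)))) := by
            rw [ENNReal.ofReal_mul hc, ← lintegral_mul_exp_neg_mul_Ioi hz,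
              lintegral_const_mul _ (by fun_prop)]
        _ ≤ _ := by
            refine setLIntegral_mono' measurableSet_Ioi fun s (hs : 0 < s) => ?_
            rw [← ENNReal.ofReal_mul hc, ← ENNReal.ofReal_mul (by positivity), ← mul_assoc]
            gcongr
            linarith)
  have e : ∫⁻ s in Ioi 0, ENNReal.ofReal (c * s) * ENNReal.ofReal ((1 + h * s) ^ (-M))
      = ENNReal.ofReal c * ∫⁻ s in Ioi 0, ENNReal.ofReal (s * (1 + h * s) ^ (-M)) := by
    rw [← lintegral_const_mul _ (by fun_prop)]
    refine setLIntegral_congr_fun measurableSet_Ioi fun s (hs : 0 < s) => ?_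
    rw [← ENNReal.ofReal_mul (by positivity), ← ENNReal.ofReal_mul hc, mul_assoc]
  rw [← hMdef, e, lintegral_mul_one_add_mul_rpow hh (by linarith : 2 < M),
    ← ENNReal.ofReal_mul hc, ENNReal.ofReal_le_ofReal_iff (mul_nonneg hc (one_div_nonneg.2
      (mul_nonneg (mul_nonneg (by positivity) (by linarith)) (by linarith))))] at hb
  refine hb.trans ?_
  rw [mul_one_div]
  have h1 : m + 1 ≤ M - 1 := by linarith
  have h2 : m ≤ M - 2 := by linarith
  have : 0 < M - 1 := by linarith
  gcongr

/-! ### The Richardson difference at one step -/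

theorem sum_range_affine (α β γ K : ℝ) (n : ℕ) :
    ∑ m ∈ Finset.range n, (α * (m + 1) + β * (K - m) + γ)
      = α * (n * (n + 1) / 2) + β * (K * n - n * (n - 1) / 2) + γ * n := by
  induction n with
  | zero => simp
  | succ n ih =>
    rw [Finset.sum_range_succ, ih]
    push_cast
    ring

theorem sum_range_two_mul (φ : ℕ → ℝ) (k : ℕ) :
    ∑ m ∈ Finset.range (2 * k), φ m = ∑ m ∈ Finset.range k, (φ (2 * m) + φ (2 * m + 1)) := by
  induction k with
  | zero => simp
  | succ k ih =>
    rw [Finset.sum_range_succ, ← ih, show 2 * (k + 1) = 2 * k + 1 + 1 by ring,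
      Finset.sum_range_succ, Finset.sum_range_succ]
    ring

section

variable {f₂ f₃ f₄ : ℝ → ℝ} {h ε c₃ c₄ : ℝ}

theorem abs_integral_left_sub_mid_le (h₂ : IsBddDeriv f₂ f₃) (h₃ : IsBddDeriv f₃ f₄) (hh : 0 < h)
    (hε : 0 < ε) (hc₄ : 0 ≤ c₄) (hf₄ : ∀ y, 0 ≤ y → |f₄ y| ≤ c₄ / (y + ε) ^ 2) {k m : ℕ}
    (hm : m < k) :
    |∫ y, f₂ y ∂(tripleGammaLaw h (m + 1) (2 * (k - m)) 0)
        - ∫ y, f₂ y ∂(tripleGammaLaw h 0 (2 * k + 2) 0)|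
      ≤ c₄ / (4 * k * (k + 1)) * (m + 1) := by
  have hk : (0 : ℝ) < k := by exact_mod_cast (by omega : 0 < k)
  have e := integral_tripleGammaLaw_left_sub_mid_sum h₂ h₃ hh (m + 1) (2 * (k - m)) 0
  rw [show 2 * (k - m) + 2 * (m + 1) = 2 * k + 2 by omega] at e
  rw [e, abs_mul, abs_of_pos (by positivity : 0 < h ^ 2 / 4)]
  -- Every law in this sum has normalised mean `k + 2`, which gives the denominators `k + 1` and
  -- `k`.
  have hb : ∀ i ∈ Finset.range (m + 1),
      |∫ y, f₄ y ∂(tripleGammaLaw h (i + 1) (2 * (k - m) + 2 * (m + 1 - i)) 0)|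
        ≤ c₄ / (h ^ 2 * (k + 1) * k) := by
    intro i hi
    refine abs_integral_tripleGammaLaw_le_of_inv_sq hh hε hc₄ _ _ _ hf₄ hk ?_
    have hi := Finset.mem_range.1 hi
    have e : ((2 * (k - m) + 2 * (m + 1 - i) : ℕ) : ℝ) = 2 * (k + 1 - i) := by
      rw [show 2 * (k - m) + 2 * (m + 1 - i) = 2 * (k + 1 - i) by omega]
      push_cast [Nat.cast_sub (by omega : i ≤ k + 1)]
      ring
    rw [e]
    push_cast
    linarith
  refine (mul_le_mul_of_nonneg_left ((Finset.abs_sum_le_sum_abs _ _).trans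
    (Finset.sum_le_sum hb)) (by positivity)).trans_eq ?_
  rw [Finset.sum_const, Finset.card_range, nsmul_eq_mul]
  push_cast
  field_simp

theorem abs_integral_mid_sub_right_le (h₂ : IsBddDeriv f₂ f₃) (h₃ : IsBddDeriv f₃ f₄) (hh : 0 < h)
    (hε : 0 < ε) (hc₄ : 0 ≤ c₄) (hf₄ : ∀ y, 0 ≤ y → |f₄ y| ≤ c₄ / (y + ε) ^ 2) {k m : ℕ}
    (hm : m < k) :
    |∫ y, f₂ y ∂(tripleGammaLaw h 0 (2 * k + 2) 0)
        - ∫ y, f₂ y ∂(tripleGammaLaw h 0 (2 * m + 2) (4 * (k - m)))|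
      ≤ c₄ / (6 * k ^ 2) * (k - m) := by
  have hk : (1 : ℝ) ≤ k := by exact_mod_cast (by omega : 1 ≤ k)
  have hkm : (0 : ℝ) ≤ k - m := by
    have : (m : ℝ) ≤ k := by exact_mod_cast hm.le
    linarith
  have e := integral_tripleGammaLaw_mid_sub_right_sum h₂ h₃ hh 0 (2 * m + 2) (2 * (k - m)) 0
  rw [show 2 * m + 2 + 2 * (k - m) = 2 * k + 2 by omega,
    show 0 + 2 * (2 * (k - m)) = 4 * (k - m) by omega] at e
  rw [e, abs_mul, abs_of_pos (by positivity : 0 < h ^ 2 / 16)]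
  -- Here the normalised mean is always `k + 3/2`. The product `(k + 1/2)(k - 1/2)` is then at least
  -- `3k²/4` because `k ≥ 1`.
  have hb : ∀ i ∈ Finset.range (2 * (k - m)),
      |∫ y, f₄ y ∂(tripleGammaLaw h 0 (2 * m + 2 + i + 1) (0 + 2 * (2 * (k - m) - i)))|
        ≤ c₄ / (h ^ 2 * ((k - 1 / 2) + 1) * (k - 1 / 2)) := by
    intro i hi
    refine abs_integral_tripleGammaLaw_le_of_inv_sq hh hε hc₄ _ _ _ hf₄ (by linarith) ?_
    have hi := Finset.mem_range.1 hi
    push_cast [Nat.cast_sub hi.le, Nat.cast_sub hm.le]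
    linarith
  refine (mul_le_mul_of_nonneg_left ((Finset.abs_sum_le_sum_abs _ _).trans
    (Finset.sum_le_sum hb)) (by positivity)).trans ?_
  rw [Finset.sum_const, Finset.card_range, nsmul_eq_mul]
  push_cast [Nat.cast_sub hm.le]
  have h1 : 3 / 4 * (k : ℝ) ^ 2 ≤ ((k - 1 / 2) + 1) * (k - 1 / 2) := by nlinarith
  have h2 : (0 : ℝ) < ((k - 1 / 2) + 1) * (k - 1 / 2) := by nlinarith
  calc h ^ 2 / 16 * (2 * (k - m) * (c₄ / (h ^ 2 * ((k - 1 / 2) + 1) * (k - 1 / 2))))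
      = (k - m) * c₄ / 8 / (((k - 1 / 2) + 1) * (k - 1 / 2)) := by
        rw [mul_assoc (h ^ 2)]
        generalize ((k : ℝ) - 1 / 2 + 1) * (k - 1 / 2) = Q at h2
        field_simp
        ring
    _ ≤ (k - m) * c₄ / 8 / (3 / 4 * (k : ℝ) ^ 2) := by gcongr
    _ = _ := by
        field_simp
        ring

theorem abs_integral_right_sub_mid_pred_le (h₂ : IsBddDeriv f₂ f₃) (hh : 0 < h)
    (hε : 0 < ε) (hc₃ : 0 ≤ c₃) (hf₃ : ∀ y, 0 ≤ y → |f₃ y| ≤ c₃ / (y + ε)) {k m : ℕ}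
    (hm : m < k) :
    |∫ y, f₂ y ∂(tripleGammaLaw h 0 (2 * m + 2) (4 * (k - m)))
        - ∫ y, f₂ y ∂(tripleGammaLaw h 0 (2 * m + 1) (4 * (k - m)))|
      ≤ c₃ / (2 * k) := by
  have hk : (0 : ℝ) < k := by exact_mod_cast (by omega : 0 < k)
  have e := integral_tripleGammaLaw_succ_mid h₂ hh 0 (2 * m + 1) (4 * (k - m))
  have hb := abs_integral_tripleGammaLaw_le_of_inv hh hε hc₃ 0 (2 * m + 2) (4 * (k - m)) hf₃ hk
    (by push_cast [Nat.cast_sub hm.le]; linarith)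
  rw [show 2 * m + 2 = 2 * m + 1 + 1 by ring] at hb ⊢
  rw [e, add_sub_cancel_left, abs_mul, abs_of_pos (by positivity)]
  refine (mul_le_mul_of_nonneg_left hb (by positivity)).trans_eq ?_
  field_simp

theorem abs_integral_right_sub_right_pred_le (h₂ : IsBddDeriv f₂ f₃) (hh : 0 < h)
    (hε : 0 < ε) (hc₃ : 0 ≤ c₃) (hf₃ : ∀ y, 0 ≤ y → |f₃ y| ≤ c₃ / (y + ε)) {k m : ℕ}
    (hm : m < k) :
    |∫ y, f₂ y ∂(tripleGammaLaw h 0 (2 * m + 2) (4 * (k - m)))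
        - ∫ y, f₂ y ∂(tripleGammaLaw h 0 (2 * m + 2) (4 * (k - m) - 2))|
      ≤ c₃ * 7 / (12 * k) := by
  have hk : (1 : ℝ) ≤ k := by exact_mod_cast (by omega : 1 ≤ k)
  obtain ⟨l, hl⟩ : ∃ l, 4 * (k - m) = l + 2 := ⟨4 * (k - m) - 2, by omega⟩
  have hl' : (l : ℝ) + 2 = 4 * (k - m) := by
    rw [← Nat.cast_sub hm.le]; exact_mod_cast hl.symm
  have e1 := integral_tripleGammaLaw_succ_right h₂ hh 0 (2 * m + 2) (l + 1)
  have e2 := integral_tripleGammaLaw_succ_right h₂ hh 0 (2 * m + 2) l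
  -- The normalised mean is `k + 3/4`, and `k - 1/4 ≥ 3k/4`. For the second unit it is `k + 1`.
  have hb2 := abs_integral_tripleGammaLaw_le_of_inv hh hε hc₃ 0 (2 * m + 2) (l + 1) hf₃
    (m := 3 / 4 * k) (by positivity) (by push_cast; linarith)
  have hb3 := abs_integral_tripleGammaLaw_le_of_inv hh hε hc₃ 0 (2 * m + 2) (l + 1 + 1) hf₃
    (m := k) (by positivity) (by push_cast; linarith)
  rw [hl, show l + 2 - 2 = l by omega, show l + 2 = l + 1 + 1 by ring, e1, e2,
    show ∀ a b c : ℝ, a + h / 4 * b + h / 4 * c - a = h / 4 * (b + c) by intros; ring, abs_mul,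
    abs_of_pos (by positivity)]
  refine (mul_le_mul_of_nonneg_left ((abs_add_le _ _).trans (add_le_add hb2 hb3))
    (by positivity)).trans_eq ?_
  field_simp
  ring

/-- The first law has normalised mean `k + 1`, the other two `k + 1/2`. Mean-preserving trades,
through the pure middle-scale law, cost only `f₄`. Adjusting the mean by removing one half-unit or
two quarter-units costs `f₃`. The constant `13/24` is the average of `1/2` and `7/12`. -/
theorem abs_integral_combination_le (h₂ : IsBddDeriv f₂ f₃) (h₃ : IsBddDeriv f₃ f₄) (hh : 0 < h)
    (hε : 0 < ε) (hc₃ : 0 ≤ c₃) (hc₄ : 0 ≤ c₄) (hf₃ : ∀ y, 0 ≤ y → |f₃ y| ≤ c₃ / (y + ε))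
    (hf₄ : ∀ y, 0 ≤ y → |f₄ y| ≤ c₄ / (y + ε) ^ 2) {k m : ℕ} (hm : m < k) :
    |∫ y, f₂ y ∂(tripleGammaLaw h (m + 1) (2 * (k - m)) 0)
        - (∫ y, f₂ y ∂(tripleGammaLaw h 0 (2 * m + 1) (4 * (k - m)))
          + ∫ y, f₂ y ∂(tripleGammaLaw h 0 (2 * m + 2) (4 * (k - m) - 2))) / 2|
      ≤ c₄ / (4 * k * (k + 1)) * (m + 1) + c₄ / (6 * k ^ 2) * (k - m) + c₃ * 13 / (24 * k) := by
  have hk : (0 : ℝ) < k := by exact_mod_cast (by omega : 0 < k)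
  have b1 := abs_le.1 (abs_integral_left_sub_mid_le h₂ h₃ hh hε hc₄ hf₄ hm)
  have b2 := abs_le.1 (abs_integral_mid_sub_right_le h₂ h₃ hh hε hc₄ hf₄ hm)
  have b3 := abs_le.1 (abs_integral_right_sub_mid_pred_le h₂ hh hε hc₃ hf₃ hm)
  have b4 := abs_le.1 (abs_integral_right_sub_right_pred_le h₂ hh hε hc₃ hf₃ hm)
  have e : c₃ * 13 / (24 * k) = (c₃ / (2 * k) + c₃ * 7 / (12 * k)) / 2 := by
    field_simp
    ring
  rw [e, abs_le]
  constructor <;> linarith [b1.1, b1.2, b2.1, b2.2, b3.1, b3.2, b4.1, b4.2]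

end

/-- Third-order Richardson-type difference at step `h`. -/
theorem abs_richardson_le {f₀ f₁ f₂ f₃ f₄ : ℝ → ℝ} {h ε c₃ c₄ : ℝ} (h₀ : IsBddDeriv f₀ f₁)
    (h₁ : IsBddDeriv f₁ f₂) (h₂ : IsBddDeriv f₂ f₃) (h₃ : IsBddDeriv f₃ f₄) (hh : 0 < h)
    (hε : 0 < ε) (hc₃ : 0 ≤ c₃) (hc₄ : 0 ≤ c₄) (hf₃ : ∀ y, 0 ≤ y → |f₃ y| ≤ c₃ / (y + ε))
    (hf₄ : ∀ y, 0 ≤ y → |f₄ y| ≤ c₄ / (y + ε) ^ 2) {k : ℕ} (hk : 0 < k) :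
    |3 * ∫ y, f₀ y ∂(scaledGammaLaw (2 * k) (h / 2)) - ∫ y, f₀ y ∂(scaledGammaLaw k h)
        - 2 * ∫ y, f₀ y ∂(scaledGammaLaw (4 * k) (h / 4))|
      ≤ h ^ 2 * (7 * c₄ + 13 * c₃) / 96 := by
  have hk' : (1 : ℝ) ≤ k := by exact_mod_cast hk
  have e1 := integral_tripleGammaLaw_left_sub_mid_sum h₀ h₁ hh k 0 0
  have e2 := integral_tripleGammaLaw_mid_sub_right_sum h₀ h₁ hh 0 0 (2 * k) 0
  -- The `2k` terms at the finer scale are paired to match the `k` terms at scale `h`. The prefactor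
  -- `2 · h²/16` is half of `h²/4`, so each pair enters as an average.
  rw [sum_range_two_mul] at e2
  simp only [zero_add] at e1 e2
  rw [show 2 * (2 * k) = 4 * k by ring] at e2
  have e3 : ∀ m ∈ Finset.range k,
      (∫ y, f₂ y ∂(tripleGammaLaw h 0 (2 * m + 1) (2 * (2 * k - 2 * m)))
        + ∫ y, f₂ y ∂(tripleGammaLaw h 0 (2 * m + 1 + 1) (2 * (2 * k - (2 * m + 1)))))
      = (∫ y, f₂ y ∂(tripleGammaLaw h 0 (2 * m + 1) (4 * (k - m)))
        + ∫ y, f₂ y ∂(tripleGammaLaw h 0 (2 * m + 2) (4 * (k - m) - 2))) := by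
    intro m hm
    have := Finset.mem_range.1 hm
    rw [show 2 * (2 * k - 2 * m) = 4 * (k - m) by omega,
      show 2 * (2 * k - (2 * m + 1)) = 4 * (k - m) - 2 by omega]
  rw [Finset.sum_congr rfl e3] at e2
  rw [tripleGammaLaw_zero_zero, tripleGammaLaw_zero_mid] at e1
  rw [tripleGammaLaw_zero_mid, tripleGammaLaw_zero_last] at e2
  have e4 : 3 * ∫ y, f₀ y ∂(scaledGammaLaw (2 * k) (h / 2)) - ∫ y, f₀ y ∂(scaledGammaLaw k h)
        - 2 * ∫ y, f₀ y ∂(scaledGammaLaw (4 * k) (h / 4))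
      = -(h ^ 2 / 4 * ∑ m ∈ Finset.range k,
        (∫ y, f₂ y ∂(tripleGammaLaw h (m + 1) (2 * (k - m)) 0)
        - (∫ y, f₂ y ∂(tripleGammaLaw h 0 (2 * m + 1) (4 * (k - m)))
          + ∫ y, f₂ y ∂(tripleGammaLaw h 0 (2 * m + 2) (4 * (k - m) - 2))) / 2)) := by
    rw [Finset.sum_sub_distrib, ← Finset.sum_div]
    linear_combination -e1 + 2 * e2
  rw [e4, abs_neg, abs_mul, abs_of_pos (by positivity : 0 < h ^ 2 / 4)]
  have hb := (Finset.abs_sum_le_sum_abs (fun m =>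
        (∫ y, f₂ y ∂(tripleGammaLaw h (m + 1) (2 * (k - m)) 0)
        - (∫ y, f₂ y ∂(tripleGammaLaw h 0 (2 * m + 1) (4 * (k - m)))
          + ∫ y, f₂ y ∂(tripleGammaLaw h 0 (2 * m + 2) (4 * (k - m) - 2))) / 2))
      (Finset.range k)).trans (Finset.sum_le_sum fun m hm =>
        abs_integral_combination_le h₂ h₃ hh hε hc₃ hc₄ hf₃ hf₄ (Finset.mem_range.1 hm))
  rw [sum_range_affine] at hb
  have e5 : c₄ / (4 * k * (k + 1)) * (k * (k + 1) / 2)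
      + c₄ / (6 * (k : ℝ) ^ 2) * (k * k - k * (k - 1) / 2) + c₃ * 13 / (24 * k) * k
      ≤ (7 * c₄ + 13 * c₃) / 24 := by
    have e6 : c₄ / (4 * k * (k + 1)) * (k * (k + 1) / 2)
      + c₄ / (6 * (k : ℝ) ^ 2) * (k * k - k * (k - 1) / 2) + c₃ * 13 / (24 * k) * k
      = c₄ / 8 + c₄ / 12 * (1 + 1 / k) + c₃ * 13 / 24 := by
      field_simp
      ring
    have e7 : 1 / (k : ℝ) ≤ 1 := by
      rw [div_le_one (by linarith)]
      exact hk'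
    rw [e6]
    have e8 : c₄ / 12 * (1 + 1 / k) ≤ c₄ / 12 * (1 + 1) := by gcongr
    linarith
  calc _ ≤ h ^ 2 / 4 * ((7 * c₄ + 13 * c₃) / 24) :=
        mul_le_mul_of_nonneg_left (hb.trans e5) (by positivity)
    _ = _ := by ring

/-! ### Uniform bounds for the gamma density -/

/-- The gamma density of shape `q` and scale `1` on `(0, ∞)`. -/
noncomputable def gammaDensity (q y : ℝ) : ℝ := y ^ (q - 1) * Real.exp (-y) / Real.Gamma q

theorem gammaDensity_nonneg {q y : ℝ} (hq : 0 < q) (hy : 0 < y) : 0 ≤ gammaDensity q y := by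
  have := Real.Gamma_pos_of_pos hq
  unfold gammaDensity
  positivity

/-- Keep only the part `x > y` of the integral for `Γ(q)` and bound `x^{q-1}` below by `y^{q-1}`;
what remains is the numerator `y^{q-1} e^{-y}`. -/
theorem gammaDensity_le_one {q y : ℝ} (hq : 1 ≤ q) (hy : 0 < y) : gammaDensity q y ≤ 1 := by
  have hq0 : 0 < q := by linarith
  rw [gammaDensity, div_le_one (Real.Gamma_pos_of_pos hq0), Real.Gamma_eq_integral hq0]
  have hi := Real.GammaIntegral_convergent hq0
  calc y ^ (q - 1) * Real.exp (-y) = ∫ x in Ioi y, y ^ (q - 1) * Real.exp (-x) := by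
        rw [integral_const_mul, integral_exp_neg_Ioi]
    _ ≤ ∫ x in Ioi y, Real.exp (-x) * x ^ (q - 1) := by
        refine setIntegral_mono_on ((integrableOn_exp_neg_Ioi y).const_mul _)
          (hi.mono_set (Ioi_subset_Ioi hy.le)) measurableSet_Ioi fun x hx => ?_
        rw [mul_comm]
        have : y ≤ x := le_of_lt hx
        gcongr
    _ ≤ ∫ x in Ioi 0, Real.exp (-x) * x ^ (q - 1) := by
        refine setIntegral_mono_set hi ?_ (Ioi_subset_Ioi hy.le).eventuallyLE
        refine (ae_restrict_iff' measurableSet_Ioi).2 (ae_of_all _ fun x (hx : 0 < x) => ?_)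
        positivity

theorem sub_sq_div_two_le_log_one_add {u : ℝ} (hu : 0 ≤ u) : u - u ^ 2 / 2 ≤ Real.log (1 + u) := by
  refine le_trans ?_ (Real.le_log_one_add_of_nonneg hu)
  rw [le_div_iff₀ (by positivity)]
  nlinarith [pow_nonneg hu 3]

theorem log_one_sub_le {s : ℝ} (hs : 0 ≤ s) (hs1 : s < 1) :
    Real.log (1 - s) ≤ -s - s ^ 2 / 2 := by
  have h := Real.hasSum_pow_div_log_of_abs_lt_one (x := s) (by rwa [abs_of_nonneg hs])
  have := sum_le_hasSum (Finset.range 2) (fun i _ => by positivity) h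
  norm_num [Finset.sum_range_succ] at this
  linarith

theorem log_le_sub_inv_div_two {x : ℝ} (hx : 1 ≤ x) : Real.log x ≤ (x - x⁻¹) / 2 := by
  have h := Real.self_le_sinh_iff.2 (Real.log_nonneg hx)
  rwa [Real.sinh_log (by linarith)] at h

/-- A weak Stirling bound. On `x > q`, `log(1+u) ≥ u - u²/2` puts the integrand above a Gaussian
centred at `q`; the half-Gaussian integral `√(2πq)/2` exceeds `√q`. -/
theorem rpow_mul_exp_neg_mul_sqrt_le_Gamma {q : ℝ} (hq : 0 < q) :
    q ^ q * Real.exp (-q) * √q ≤ Real.Gamma (q + 1) := by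
  have hi := Real.GammaIntegral_convergent (by linarith : 0 < q + 1)
  rw [Real.Gamma_eq_integral (by linarith)]
  simp only [add_sub_cancel_right] at hi ⊢
  have hg : Integrable fun v : ℝ => Real.exp (-(1 / (2 * q)) * v ^ 2) :=
    integrable_exp_neg_mul_sq (by positivity)
  have hpt : ∀ x ∈ Ioi q, q ^ q * Real.exp (-q) * Real.exp (-(1 / (2 * q)) * (x - q) ^ 2)
      ≤ Real.exp (-x) * x ^ q := by
    intro x hx
    have hx : q < x := hx
    have hx0 : 0 < x := hq.trans hx
    rw [Real.rpow_def_of_pos hq, Real.rpow_def_of_pos hx0, ← Real.exp_add, ← Real.exp_add,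
      ← Real.exp_add]
    refine Real.exp_le_exp.2 ?_
    have hl := sub_sq_div_two_le_log_one_add (u := (x - q) / q)
      (div_nonneg (by linarith) hq.le)
    rw [show 1 + (x - q) / q = x / q by field_simp; ring, Real.log_div hx0.ne' hq.ne'] at hl
    have hl2 := mul_le_mul_of_nonneg_left hl hq.le
    have e : q * ((x - q) / q - ((x - q) / q) ^ 2 / 2)
        = x - q - 1 / (2 * q) * (x - q) ^ 2 := by field_simp
    rw [e] at hl2
    linarith
  have hsub : MeasurePreserving (fun x : ℝ => x - q) := measurePreserving_sub_right volume q
  have hpre : (fun x : ℝ => x - q) ⁻¹' Ioi 0 = Ioi q := by ext; simp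
  have htr : ∫ x in Ioi q, Real.exp (-(1 / (2 * q)) * (x - q) ^ 2)
      = ∫ v in Ioi 0, Real.exp (-(1 / (2 * q)) * v ^ 2) := by
    rw [← hpre]
    exact hsub.setIntegral_preimage_emb (MeasurableEquiv.subRight q).measurableEmbedding
      (fun v => Real.exp (-(1 / (2 * q)) * v ^ 2)) (Ioi 0)
  have hgi : IntegrableOn (fun x => Real.exp (-(1 / (2 * q)) * (x - q) ^ 2)) (Ioi q) :=
    (hg.comp_sub_right q).integrableOn
  calc q ^ q * Real.exp (-q) * √q
      ≤ q ^ q * Real.exp (-q) * (√(Real.pi / (1 / (2 * q))) / 2) := by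
        gcongr
        have : 2 * √q = √(4 * q) := by
          rw [Real.sqrt_mul (by norm_num), show (4 : ℝ) = 2 ^ 2 by norm_num,
            Real.sqrt_sq (by norm_num)]
        have h2 : √(4 * q) ≤ √(Real.pi / (1 / (2 * q))) := by
          refine Real.sqrt_le_sqrt ?_
          rw [div_div_eq_mul_div, div_one]
          nlinarith [Real.pi_gt_three]
        linarith
    _ = ∫ x in Ioi q, q ^ q * Real.exp (-q) * Real.exp (-(1 / (2 * q)) * (x - q) ^ 2) := by
        rw [integral_const_mul, htr, integral_gaussian_Ioi]
    _ ≤ ∫ x in Ioi q, Real.exp (-x) * x ^ q :=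
        setIntegral_mono_on (hgi.const_mul _) (hi.mono_set (Ioi_subset_Ioi hq.le))
          measurableSet_Ioi hpt
    _ ≤ ∫ x in Ioi 0, Real.exp (-x) * x ^ q := by
        refine setIntegral_mono_set hi ?_ (Ioi_subset_Ioi hq.le).eventuallyLE
        refine (ae_restrict_iff' measurableSet_Ioi).2 (ae_of_all _ fun x (hx : 0 < x) => ?_)
        positivity

theorem gammaDensity_le_of_le_rpow {q y B : ℝ} (hq : 0 < q) (hy : 0 < y)
    (h : y ^ (q - 1) * Real.exp (-y) ≤ q ^ (q - 1) * Real.exp (-q) * B) :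
    √q * gammaDensity q y ≤ B := by
  have hG := Real.Gamma_pos_of_pos hq
  have hst := rpow_mul_exp_neg_mul_sqrt_le_Gamma hq
  rw [Real.Gamma_add_one hq.ne'] at hst
  have e : q ^ q = q * q ^ (q - 1) := by
    rw [mul_comm, ← Real.rpow_add_one hq.ne', sub_add_cancel]
  rw [e] at hst
  have hst' : q ^ (q - 1) * Real.exp (-q) * √q ≤ Real.Gamma q := by
    refine le_of_mul_le_mul_left ?_ hq
    linarith
  have hB : 0 ≤ B := by
    by_contra! hB
    have : q ^ (q - 1) * Real.exp (-q) * B < 0 := mul_neg_of_pos_of_neg (by positivity) hB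
    have : 0 ≤ y ^ (q - 1) * Real.exp (-y) := by positivity
    linarith
  rw [gammaDensity, mul_div_assoc', div_le_iff₀ hG]
  calc √q * (y ^ (q - 1) * Real.exp (-y))
      ≤ √q * (q ^ (q - 1) * Real.exp (-q) * B) := by gcongr
    _ = B * (q ^ (q - 1) * Real.exp (-q) * √q) := by ring
    _ ≤ B * Real.Gamma q := by gcongr

theorem sqrt_mul_gammaDensity_le_left {q y : ℝ} (hq : 1 ≤ q) (hy : 0 < y) (hyq : y ≤ q) :
    √q * gammaDensity q y ≤ Real.exp (3 / 2 - (q - y) ^ 2 / q / 2) := by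
  have hq0 : 0 < q := by linarith
  refine gammaDensity_le_of_le_rpow hq0 hy ?_
  rw [Real.rpow_def_of_pos hq0, Real.rpow_def_of_pos hy, ← Real.exp_add, ← Real.exp_add,
    ← Real.exp_add]
  refine Real.exp_le_exp.2 ?_
  obtain ⟨s, hs⟩ : ∃ s, s = (q - y) / q := ⟨_, rfl⟩
  have hs0 : 0 ≤ s := hs ▸ div_nonneg (by linarith) hq0.le
  have hyq' : y = q * (1 - s) := by rw [hs]; field_simp; ring
  have hs1 : s < 1 := by
    by_contra! h
    have : q * (1 - s) ≤ 0 := mul_nonpos_of_nonneg_of_nonpos hq0.le (by linarith)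
    linarith
  have hl := log_one_sub_le hs0 hs1
  have e : (q - y) ^ 2 / q = q * s ^ 2 := by rw [hyq']; field_simp; ring
  rw [e, hyq', Real.log_mul hq0.ne' (by linarith)]
  -- With `y = q(1-s)` the exponent left over is `s + s²/2`, at most `3/2` because `s < 1`.
  nlinarith [mul_le_mul_of_nonneg_left hl (by linarith : 0 ≤ q - 1)]

theorem sqrt_mul_gammaDensity_le_right {q y : ℝ} (hq : 0 < q) (hyq : q ≤ y) :
    √q * gammaDensity q y ≤ q / y * Real.exp (-((y - q) ^ 2 / y / 2)) := by
  have hy : 0 < y := by linarith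
  refine gammaDensity_le_of_le_rpow hq hy ?_
  have e1 : y ^ (q - 1) = y ^ q / y := Real.rpow_sub_one hy.ne' q
  have e2 : q ^ (q - 1) = q ^ q / q := Real.rpow_sub_one hq.ne' q
  have key : y ^ q * Real.exp (-y)
      ≤ q ^ q * Real.exp (-q) * Real.exp (-((y - q) ^ 2 / y / 2)) := by
    rw [Real.rpow_def_of_pos hq, Real.rpow_def_of_pos hy, ← Real.exp_add, ← Real.exp_add,
      ← Real.exp_add]
    refine Real.exp_le_exp.2 ?_
    have hl := log_le_sub_inv_div_two ((one_le_div hq).2 hyq)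
    rw [Real.log_div hy.ne' hq.ne'] at hl
    have hl2 := mul_le_mul_of_nonneg_left hl hq.le
    have e : q * ((y / q - (y / q)⁻¹) / 2) = y - q - (y - q) ^ 2 / y / 2 := by
      field_simp
      ring
    rw [e] at hl2
    linarith
  rw [e1, e2]
  calc y ^ q / y * Real.exp (-y) = y ^ q * Real.exp (-y) / y := by ring
    _ ≤ q ^ q * Real.exp (-q) * Real.exp (-((y - q) ^ 2 / y / 2)) / y := by gcongr
    _ = _ := by field_simp

theorem exp_one_sq_le : Real.exp 1 ^ 2 ≤ 9 := by
  nlinarith [Real.exp_one_lt_d9, Real.exp_pos 1]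

/-- For `n = 1, 2, 3` the function `z^n exp(3/2 - z²/2)` peaks on `z ≥ 0` at `z² = n`. Each of the
three bounds uses `1 + x ≤ e^x` with equality at that point. -/
theorem mul_exp_le {z : ℝ} : z * Real.exp (3 / 2 - z ^ 2 / 2) ≤ 3 := by
  refine le_of_sq_le_sq ?_ (by norm_num)
  rw [mul_pow, ← Real.exp_nat_mul]
  have h := Real.add_one_le_exp (z ^ 2 - 1)
  calc z ^ 2 * Real.exp ((2 : ℕ) * (3 / 2 - z ^ 2 / 2))
      ≤ Real.exp (z ^ 2 - 1) * Real.exp ((2 : ℕ) * (3 / 2 - z ^ 2 / 2)) := by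
        gcongr
        linarith
    _ = Real.exp 1 ^ 2 := by
        rw [← Real.exp_add, ← Real.exp_nat_mul]
        congr 1
        push_cast
        ring
    _ ≤ 3 ^ 2 := by linarith [exp_one_sq_le]

theorem sq_mul_exp_le {z : ℝ} : z ^ 2 * Real.exp (3 / 2 - z ^ 2 / 2) ≤ 4 := by
  have h := Real.add_one_le_exp (z ^ 2 / 2 - 1)
  have hh : Real.exp (1 / 2) ≤ 2 := by
    refine le_of_sq_le_sq ?_ (by norm_num)
    rw [← Real.exp_nat_mul]
    norm_num
    linarith [Real.exp_one_lt_d9]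
  calc z ^ 2 * Real.exp (3 / 2 - z ^ 2 / 2)
      ≤ (2 * Real.exp (z ^ 2 / 2 - 1)) * Real.exp (3 / 2 - z ^ 2 / 2) := by
        gcongr
        linarith
    _ = 2 * Real.exp (1 / 2) := by
        rw [mul_assoc, ← Real.exp_add]
        congr 2
        ring
    _ ≤ 4 := by linarith

theorem cube_mul_exp_le {z : ℝ} : z ^ 3 * Real.exp (3 / 2 - z ^ 2 / 2) ≤ 6 := by
  refine le_of_sq_le_sq ?_ (by norm_num)
  rw [mul_pow, ← Real.exp_nat_mul]
  have h := Real.add_one_le_exp (z ^ 2 / 3 - 1)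
  have h2 : (z ^ 2 / 3) ^ 3 ≤ Real.exp (z ^ 2 / 3 - 1) ^ 3 := by
    gcongr
    linarith
  have e : Real.exp (z ^ 2 / 3 - 1) ^ 3 * Real.exp ((2 : ℕ) * (3 / 2 - z ^ 2 / 2)) = 1 := by
    rw [← Real.exp_nat_mul, ← Real.exp_add, Real.exp_eq_one_iff]
    push_cast
    ring
  calc (z ^ 3) ^ 2 * Real.exp ((2 : ℕ) * (3 / 2 - z ^ 2 / 2))
      = 27 * ((z ^ 2 / 3) ^ 3 * Real.exp ((2 : ℕ) * (3 / 2 - z ^ 2 / 2))) := by ring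
    _ ≤ 27 * (Real.exp (z ^ 2 / 3 - 1) ^ 3 * Real.exp ((2 : ℕ) * (3 / 2 - z ^ 2 / 2))) := by
        gcongr
    _ ≤ 6 ^ 2 := by rw [e]; norm_num

theorem gammaDensity_mul_div {q y : ℝ} (hq : 0 < q) (hy : 0 < y) :
    gammaDensity q y * (y / q) = gammaDensity (q + 1) y := by
  have := Real.Gamma_pos_of_pos hq
  rw [gammaDensity, gammaDensity, Real.Gamma_add_one hq.ne', add_sub_cancel_right,
    Real.rpow_sub_one hy.ne']
  field_simp

theorem abs_gammaDensity_mul_sub_le {q y : ℝ} (hq : 1 ≤ q) (hy : 0 < y) :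
    |gammaDensity q y / q * (q - y)| ≤ 1 := by
  have hq0 : 0 < q := by linarith
  have e : gammaDensity q y / q * (q - y) = gammaDensity q y - gammaDensity (q + 1) y := by
    rw [← gammaDensity_mul_div hq0 hy]
    field_simp
  rw [e, abs_le]
  have h1 := gammaDensity_le_one hq hy
  have h2 := gammaDensity_nonneg hq0 hy
  have h3 := gammaDensity_le_one (by linarith : 1 ≤ q + 1) hy
  have h4 := gammaDensity_nonneg (by linarith : 0 < q + 1) hy
  constructor <;> linarith

theorem gammaDensity_moments_left {q y : ℝ} (hq : 1 ≤ q) (hy : 0 < y) (hyq : y ≤ q) :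
    gammaDensity q y * (q - y) ≤ 3 ∧ gammaDensity q y / q * (q - y) ^ 2 ≤ 4
      ∧ gammaDensity q y / q * (q - y) ^ 3 ≤ 6 := by
  have hq0 : 0 < q := by linarith
  have hb := sqrt_mul_gammaDensity_le_left hq hy hyq
  have hg := gammaDensity_nonneg hq0 hy
  generalize gammaDensity q y = g at hb hg
  obtain ⟨r, hr, hr1, rfl⟩ : ∃ r : ℝ, r = √q ∧ 1 ≤ r ∧ q = r ^ 2 :=
    ⟨√q, rfl, Real.one_le_sqrt.2 hq, (Real.sq_sqrt hq0.le).symm⟩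
  rw [← hr] at hb
  have hr0 : 0 < r := by linarith
  -- Standardised deviation from `q`, in units of `√q`.
  obtain ⟨z, hz⟩ : ∃ z, z = (r ^ 2 - y) / r := ⟨_, rfl⟩
  have hz0 : 0 ≤ z := hz ▸ div_nonneg (by linarith) hr0.le
  have hy' : r ^ 2 - y = z * r := by rw [hz]; field_simp
  rw [hy'] at hb ⊢
  rw [show (z * r) ^ 2 / r ^ 2 / 2 = z ^ 2 / 2 by field_simp] at hb
  refine ⟨?_, ?_, ?_⟩
  · calc g * (z * r) = z * (r * g) := by ring
      _ ≤ z * Real.exp (3 / 2 - z ^ 2 / 2) := by gcongr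
      _ ≤ 3 := mul_exp_le
  · calc g / r ^ 2 * (z * r) ^ 2 = z ^ 2 * (1 * g) := by field_simp
      _ ≤ z ^ 2 * (r * g) := by gcongr
      _ ≤ z ^ 2 * Real.exp (3 / 2 - z ^ 2 / 2) := by gcongr
      _ ≤ 4 := sq_mul_exp_le
  · calc g / r ^ 2 * (z * r) ^ 3 = z ^ 3 * (r * g) := by field_simp
      _ ≤ z ^ 3 * Real.exp (3 / 2 - z ^ 2 / 2) := by gcongr
      _ ≤ 6 := cube_mul_exp_le

theorem gammaDensity_moments_right {q y : ℝ} (hq : 1 ≤ q) (hyq : q ≤ y) :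
    gammaDensity q y * (y - q) ≤ 1 ∧ gammaDensity q y / q * (y - q) ^ 2 ≤ 2
      ∧ gammaDensity q y / q * (y - q) ^ 3 ≤ 8 := by
  have hq0 : 0 < q := by linarith
  have hy : 0 < y := by linarith
  have hb := sqrt_mul_gammaDensity_le_right hq0 hyq
  have hg := gammaDensity_nonneg hq0 hy
  generalize gammaDensity q y = g at hb hg
  obtain ⟨w, hw⟩ : ∃ w, w = (y - q) ^ 2 / y := ⟨_, rfl⟩
  have hw0 : 0 ≤ w := hw ▸ by positivity
  have hwy : (y - q) ^ 2 = w * y := by rw [hw]; field_simp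
  rw [← hw] at hb
  obtain ⟨r, hr, hr1, hrq⟩ : ∃ r : ℝ, r = √q ∧ 1 ≤ r ∧ q = r ^ 2 :=
    ⟨√q, rfl, Real.one_le_sqrt.2 hq, (Real.sq_sqrt hq0.le).symm⟩
  rw [← hr] at hb
  have hr0 : 0 < r := by linarith
  have hv : 0 ≤ y - q := by linarith
  obtain ⟨E, hE⟩ : ∃ E, E = Real.exp (-(w / 2)) := ⟨_, rfl⟩
  have hE0 : 0 < E := hE ▸ Real.exp_pos _
  rw [← hE] at hb
  -- The source of the numerical bounds: it yields `wE ≤ 2` and `w(w+1)E ≤ 8`.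
  have hEw : (1 + w / 2 + (w / 2) ^ 2 / 2) * E ≤ 1 := by
    have h1 := Real.quadratic_le_exp_of_nonneg (x := w / 2) (by positivity)
    calc (1 + w / 2 + (w / 2) ^ 2 / 2) * E ≤ Real.exp (w / 2) * E := by gcongr
      _ = 1 := by rw [hE, ← Real.exp_add]; simp
  have hP : r * (g * y / q) ≤ E := by
    calc r * (g * y / q) = (r * g) * y / q := by ring
      _ ≤ (q / y * E) * y / q := by gcongr
      _ = E := by field_simp
  obtain ⟨P, hPdef⟩ : ∃ P, P = g * y / q := ⟨_, rfl⟩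
  have hP0 : 0 ≤ P := hPdef ▸ by positivity
  have hg' : g = P * q / y := by rw [hPdef]; field_simp
  rw [← hPdef] at hP
  have hPE : P ≤ E := le_trans (by nlinarith) hP
  -- As `q ≥ 1`, `y(y-2q) ≤ (y-q)² ≤ q(y-q)²`, so `y ≤ q(2+w)` and `(y-q)² = wy ≤ q(w+1)²`.
  have hvr : y - q ≤ r * (w + 1) := by
    refine le_of_sq_le_sq ?_ (by positivity)
    have h1 : (y - 2 * q) * y ≤ q * (w * y) := by rw [← hwy]; nlinarith [sq_nonneg (y - q)]
    have h2 : y - 2 * q ≤ q * w := by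
      refine le_of_mul_le_mul_right ?_ hy
      linarith
    rw [hwy, mul_pow, ← hrq]
    nlinarith
  have h1 : g * (y - q) ≤ 1 := by
    refine le_of_sq_le_sq ?_ (by norm_num)
    have hqy : q / y ≤ 1 := (div_le_one hy).2 hyq
    calc (g * (y - q)) ^ 2 = (r * P) ^ 2 * w * (q / y) := by
          rw [mul_pow, hwy, hg', mul_pow r, ← hrq]; field_simp
      _ ≤ E ^ 2 * w * 1 := by gcongr
      _ ≤ 1 ^ 2 := by
          have h3 : (1 + w / 2) * E ≤ 1 := by nlinarith [sq_nonneg (w / 2)]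
          have h4 : ((1 + w / 2) * E) ^ 2 ≤ 1 ^ 2 := by gcongr
          nlinarith [sq_nonneg (w / 2 * E), sq_nonneg E]
  refine ⟨h1, ?_, ?_⟩
  · calc g / q * (y - q) ^ 2 = w * P := by rw [hwy, hg']; field_simp
      _ ≤ w * E := by gcongr
      _ ≤ 2 := by nlinarith [sq_nonneg (w / 2)]
  · calc g / q * (y - q) ^ 3 = w * (P * (y - q)) := by rw [pow_succ, hwy, hg']; field_simp
      _ ≤ w * (P * (r * (w + 1))) := by gcongr
      _ = w * (w + 1) * (r * P) := by ring
      _ ≤ w * (w + 1) * E := by gcongr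
      _ ≤ 8 := by nlinarith

theorem abs_gammaDensity_mul_quadratic_le {q y : ℝ} (hq : 1 ≤ q) (hy : 0 < y) :
    |gammaDensity q y / q * ((y - q) ^ 2 - q)| ≤ 4 := by
  have hq0 : 0 < q := by linarith
  have hg := gammaDensity_nonneg hq0 hy
  have hg1 := gammaDensity_le_one hq hy
  have e : gammaDensity q y / q * ((y - q) ^ 2 - q)
      = gammaDensity q y / q * (y - q) ^ 2 - gammaDensity q y := by
    field_simp
  have hn : 0 ≤ gammaDensity q y / q * (y - q) ^ 2 := by positivity
  have hu : gammaDensity q y / q * (y - q) ^ 2 ≤ 4 := by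
    rcases le_total y q with hyq | hyq
    · have := (gammaDensity_moments_left hq hy hyq).2.1
      rwa [sub_sq_comm] at this
    · linarith [(gammaDensity_moments_right hq hyq).2.1]
  rw [e, abs_le]
  constructor <;> linarith

theorem abs_gammaDensity_mul_cubic_le {q y : ℝ} (hq : 1 ≤ q) (hy : 0 < y) :
    |gammaDensity q y / q * ((q - y) ^ 3 - 3 * q * (q - y) + 2 * q)| ≤ 10 := by
  have hq0 : 0 < q := by linarith
  have hg := gammaDensity_nonneg hq0 hy
  have hg1 := gammaDensity_le_one hq hy
  have e : gammaDensity q y / q * ((q - y) ^ 3 - 3 * q * (q - y) + 2 * q)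
      = gammaDensity q y / q * (q - y) ^ 3 - 3 * (gammaDensity q y * (q - y))
        + 2 * gammaDensity q y := by
    field_simp
  rw [e, abs_le]
  rcases le_total y q with hyq | hyq
  · obtain ⟨h1, -, h3⟩ := gammaDensity_moments_left hq hy hyq
    have hv : 0 ≤ q - y := by linarith
    have h4 : 0 ≤ gammaDensity q y / q * (q - y) ^ 3 := by positivity
    have h5 : 0 ≤ gammaDensity q y * (q - y) := by positivity
    constructor <;> linarith
  · obtain ⟨h1, -, h3⟩ := gammaDensity_moments_right hq hyq
    have hv : 0 ≤ y - q := by linarith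
    have h4 : 0 ≤ gammaDensity q y / q * (y - q) ^ 3 := by positivity
    have h5 : 0 ≤ gammaDensity q y * (y - q) := by positivity
    have e1 : gammaDensity q y / q * (q - y) ^ 3 = -(gammaDensity q y / q * (y - q) ^ 3) := by ring
    have e2 : gammaDensity q y * (q - y) = -(gammaDensity q y * (y - q)) := by ring
    rw [e1, e2]
    constructor <;> linarith

/-! ### Derivatives of `gammaDF` and the one-step bound -/

theorem gammaDF_nonneg (p x : ℝ) : 0 ≤ gammaDF p x := cdf_nonneg _ _

theorem gammaDF_le_one (p x : ℝ) : gammaDF p x ≤ 1 := cdf_le_one _ _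

theorem abs_gammaDF_le_one (p x : ℝ) : |gammaDF p x| ≤ 1 := by
  rw [abs_of_nonneg (gammaDF_nonneg p x)]
  exact gammaDF_le_one p x

theorem integrable_gammaPDFReal {p : ℝ} (hp : 0 < p) : Integrable (gammaPDFReal p 1) := by
  refine ⟨(measurable_gammaPDFReal p 1).aestronglyMeasurable, ?_⟩
  rw [hasFiniteIntegral_iff_ofReal (ae_of_all _ (gammaPDFReal_nonneg hp one_pos))]
  have := lintegral_gammaPDF_eq_one hp one_pos
  simp only [gammaPDF] at this
  rw [this]
  exact ENNReal.one_lt_top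

theorem gammaDF_eq_add_integral {p : ℝ} (hp : 0 < p) (x : ℝ) :
    gammaDF p x = gammaDF p 0 + ∫ y in (0 : ℝ)..x, gammaPDFReal p 1 y := by
  have hi := integrable_gammaPDFReal hp
  rw [gammaDF, gammaDF, cdf_gammaMeasure_eq_integral hp one_pos,
    cdf_gammaMeasure_eq_integral hp one_pos,
    ← intervalIntegral.integral_Iic_sub_Iic hi.integrableOn hi.integrableOn]
  ring

theorem continuous_gammaDF {p : ℝ} (hp : 0 < p) : Continuous (gammaDF p) := by
  have hi := integrable_gammaPDFReal hp
  have : gammaDF p = fun x => gammaDF p 0 + ∫ y in (0 : ℝ)..x, gammaPDFReal p 1 y :=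
    funext fun x => gammaDF_eq_add_integral hp x
  rw [this]
  exact continuous_const.add
    (intervalIntegral.continuous_primitive (fun a b => hi.intervalIntegrable) 0)

theorem hasDerivAt_gammaDensity {u y : ℝ} (hy : 0 < y) :
    HasDerivAt (gammaDensity u) (gammaDensity u y * ((u - 1) / y - 1)) y := by
  have h := (hasDerivAt_rpow_mul_exp_neg (u := u - 1) hy).div_const (Real.Gamma u)
  refine h.congr_deriv ?_
  rw [gammaDensity, Real.rpow_sub_one hy.ne' (u - 1)]
  ring

theorem hasDerivAt_gammaDF {p y : ℝ} (hp : 0 < p) (hy : 0 < y) :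
    HasDerivAt (gammaDF p) (gammaDensity p y) y := by
  have hi := integrable_gammaPDFReal hp
  have heq : ∀ z, 0 < z → gammaPDFReal p 1 z = gammaDensity p z := by
    intro z hz
    rw [gammaPDFReal, if_pos hz.le, gammaDensity, Real.one_rpow, one_mul]
    ring
  have hev : gammaDensity p =ᶠ[𝓝 y] gammaPDFReal p 1 := by
    filter_upwards [Ioi_mem_nhds hy] with z hz using (heq z hz).symm
  have hc : ContinuousAt (gammaPDFReal p 1) y :=
    (hasDerivAt_gammaDensity hy).continuousAt.congr hev
  have h := intervalIntegral.integral_hasDerivAt_right (a := 0) (hi.intervalIntegrable)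
    (measurable_gammaPDFReal p 1).stronglyMeasurable.stronglyMeasurableAtFilter hc
  have h2 := h.const_add (gammaDF p 0)
  rw [heq y hy] at h2
  exact h2.congr_of_eventuallyEq (Eventually.of_forall fun x => gammaDF_eq_add_integral hp x)

section

variable {q y : ℝ}

theorem hasDerivAt_gammaDensity_add_one (hq : 0 < q) (hy : 0 < y) :
    HasDerivAt (gammaDensity (q + 1)) (gammaDensity q y / q * (q - y)) y := by
  refine (hasDerivAt_gammaDensity (u := q + 1) hy).congr_deriv ?_
  rw [← gammaDensity_mul_div hq hy]
  field_simp
  ring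

theorem hasDerivAt_gammaDensity_mul_sub (hq : 0 < q) (hy : 0 < y) :
    HasDerivAt (fun y => gammaDensity q y / q * (q - y))
      (gammaDensity q y / q * ((y - q) ^ 2 - q) / y) y := by
  refine (((hasDerivAt_gammaDensity (u := q) hy).div_const q).mul
    ((hasDerivAt_id y).const_sub q)).congr_deriv ?_
  simp only [id]
  field_simp
  ring

theorem hasDerivAt_gammaDensity_mul_quadratic (hq : 0 < q) (hy : 0 < y) :
    HasDerivAt (fun y => gammaDensity q y / q * ((y - q) ^ 2 - q) / y)
      (gammaDensity q y / q * ((q - y) ^ 3 - 3 * q * (q - y) + 2 * q) / y ^ 2) y := by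
  have h1 : HasDerivAt (fun y => (y - q) ^ 2 - q) (2 * (y - q)) y := by
    simpa using (((hasDerivAt_id y).sub_const q).pow 2).sub_const q
  refine ((((hasDerivAt_gammaDensity (u := q) hy).div_const q).mul h1).div
    (hasDerivAt_id y) hy.ne').congr_deriv ?_
  simp only [id, Pi.mul_apply]
  field_simp
  ring

theorem continuousOn_gammaDensity_mul_cubic :
    ContinuousOn (fun y => gammaDensity q y / q * ((q - y) ^ 3 - 3 * q * (q - y) + 2 * q) / y ^ 2)
      (Ioi 0) := by
  intro y hy
  have hy : 0 < y := hy
  have h1 : ContinuousAt (gammaDensity q) y := (hasDerivAt_gammaDensity hy).continuousAt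
  exact (((h1.div_const q).mul (by fun_prop)).div (by fun_prop) (by positivity)).continuousWithinAt

end

/-- The higher derivatives of `gammaDF` may blow up at `0`. Replacing `y` by `max y 0 + ε` evaluates
them only on `[ε, ∞)`, where they are bounded, and changes only the shift on the support of the
laws. -/
theorem IsBddDeriv.of_shift {f f' : ℝ → ℝ} {ε C C' : ℝ} (hε : 0 < ε)
    (hd : ∀ y, 0 < y → HasDerivAt f (f' y) y) (hc : ContinuousOn f' (Ioi 0))
    (hC : ∀ y, ε ≤ y → |f y| ≤ C) (hC' : ∀ y, ε ≤ y → |f' y| ≤ C') :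
    IsBddDeriv (fun y => f (max y 0 + ε)) (fun y => f' (max y 0 + ε)) where
  cont := by
    have hf : ContinuousOn f (Ioi 0) := fun y hy => (hd y hy).continuousAt.continuousWithinAt
    refine hf.comp_continuous (by fun_prop) fun y => ?_
    have := le_max_right y 0
    exact mem_Ioi.2 (by linarith)
  bdd := ⟨C, fun y => hC _ (by linarith [le_max_right y 0])⟩
  cont' := by
    refine hc.comp_continuous (by fun_prop) fun y => ?_
    have := le_max_right y 0
    exact mem_Ioi.2 (by linarith)
  bdd' := ⟨C', fun y => hC' _ (by linarith [le_max_right y 0])⟩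
  deriv y hy := by
    have h1 : HasDerivAt (fun y => f (y + ε)) (f' (y + ε)) y :=
      (hd (y + ε) (by positivity)).comp_add_const y ε
    rw [max_eq_left hy.le]
    refine h1.congr_of_eventuallyEq ?_
    filter_upwards [Ioi_mem_nhds hy] with z hz
    rw [max_eq_left (le_of_lt hz)]

theorem abs_richardson_gammaDF_shift_le {p h ε : ℝ} (hp : 2 ≤ p) (hh : 0 < h) (hε : 0 < ε) {k : ℕ}
    (hk : 0 < k) :
    |3 * ∫ y, gammaDF p (max y 0 + ε) ∂(scaledGammaLaw (2 * k) (h / 2))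
        - ∫ y, gammaDF p (max y 0 + ε) ∂(scaledGammaLaw k h)
        - 2 * ∫ y, gammaDF p (max y 0 + ε) ∂(scaledGammaLaw (4 * k) (h / 4))|
      ≤ h ^ 2 * (122 / 96) := by
  obtain ⟨q, rfl⟩ : ∃ q, p = q + 1 := ⟨p - 1, by ring⟩
  have hq : 1 ≤ q := by linarith
  have hq0 : 0 < q := by linarith
  have pos : ∀ y, ε ≤ y → 0 < y := fun y hy => hε.trans_le hy
  have d0 : ∀ y, 0 < y → HasDerivAt (gammaDF (q + 1)) (gammaDensity (q + 1) y) y :=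
    fun y hy => hasDerivAt_gammaDF (by linarith) hy
  have d1 := fun (y : ℝ) (hy : 0 < y) => hasDerivAt_gammaDensity_add_one hq0 hy
  have d2 := fun (y : ℝ) (hy : 0 < y) => hasDerivAt_gammaDensity_mul_sub hq0 hy
  have d3 := fun (y : ℝ) (hy : 0 < y) => hasDerivAt_gammaDensity_mul_quadratic hq0 hy
  have b1 : ∀ y, ε ≤ y → |gammaDensity (q + 1) y| ≤ 1 := fun y hy => by
    rw [abs_of_nonneg (gammaDensity_nonneg (by linarith) (pos y hy))]
    exact gammaDensity_le_one (by linarith) (pos y hy)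
  have b3' : ∀ y, 0 < y → |gammaDensity q y / q * ((y - q) ^ 2 - q) / y| ≤ 4 / y := fun y hy => by
    rw [abs_div, abs_of_pos hy]
    exact div_le_div_of_nonneg_right (abs_gammaDensity_mul_quadratic_le hq hy) hy.le
  have b4' : ∀ y, 0 < y →
      |gammaDensity q y / q * ((q - y) ^ 3 - 3 * q * (q - y) + 2 * q) / y ^ 2| ≤ 10 / y ^ 2 :=
    fun y hy => by
      rw [abs_div, abs_of_pos (by positivity : 0 < y ^ 2)]
      exact div_le_div_of_nonneg_right (abs_gammaDensity_mul_cubic_le hq hy) (by positivity)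
  have b3 : ∀ y, ε ≤ y → |gammaDensity q y / q * ((y - q) ^ 2 - q) / y| ≤ 4 / ε :=
    fun y hy => (b3' y (pos y hy)).trans (by gcongr)
  have b4 : ∀ y, ε ≤ y →
      |gammaDensity q y / q * ((q - y) ^ 3 - 3 * q * (q - y) + 2 * q) / y ^ 2| ≤ 10 / ε ^ 2 :=
    fun y hy => (b4' y (pos y hy)).trans (by gcongr)
  have cont : ∀ {f f' : ℝ → ℝ}, (∀ y, 0 < y → HasDerivAt f (f' y) y) → ContinuousOn f (Ioi 0) :=
    fun hd y hy => (hd y hy).continuousAt.continuousWithinAt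
  have b2 := fun (y : ℝ) (hy : ε ≤ y) => abs_gammaDensity_mul_sub_le hq (pos y hy)
  have h0 := IsBddDeriv.of_shift hε d0 (cont d1) (fun y _ => abs_gammaDF_le_one _ y) b1
  have h1 := IsBddDeriv.of_shift hε d1 (cont d2) b1 b2
  have h2 := IsBddDeriv.of_shift hε d2 (cont d3) b2 b3
  have h3 := IsBddDeriv.of_shift hε d3 continuousOn_gammaDensity_mul_cubic b3 b4
  -- These constants give `7 · 10 + 13 · 4 = 122`.
  have := abs_richardson_le h0 h1 h2 h3 hh hε (c₃ := 4) (c₄ := 10) (by norm_num) (by norm_num)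
    (fun y hy => by rw [max_eq_left hy]; exact b3' _ (by positivity))
    (fun y hy => by rw [max_eq_left hy]; exact b4' _ (by positivity)) hk
  norm_num at this ⊢
  linarith

theorem tendsto_integral_gammaDF_shift {p : ℝ} (hp : 0 < p) {μ : Measure ℝ}
    [IsProbabilityMeasure μ] (hμ : ∀ᵐ y ∂μ, 0 ≤ y) :
    Tendsto (fun ε => ∫ y, gammaDF p (max y 0 + ε) ∂μ) (𝓝[>] 0) (𝓝 (∫ y, gammaDF p y ∂μ)) := by
  have hc := continuous_gammaDF hp
  refine tendsto_integral_filter_of_dominated_convergence (fun _ => 1)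
    (Eventually.of_forall fun ε => ?_)
    (Eventually.of_forall fun ε => ae_of_all _ fun y => abs_gammaDF_le_one _ _)
    (integrable_const 1) ?_
  · exact (hc.comp (by fun_prop)).aestronglyMeasurable
  · filter_upwards [hμ] with y hy
    have h1 : Tendsto (fun ε => gammaDF p (max y 0 + ε)) (𝓝 0) (𝓝 (gammaDF p (max y 0 + 0))) :=
      (hc.comp (continuous_const.add continuous_id)).tendsto 0
    rw [max_eq_left hy, add_zero] at h1
    rw [max_eq_left hy]
    exact h1.mono_left nhdsWithin_le_nhds

theorem abs_richardson_gammaDF_le {p h : ℝ} (hp : 2 ≤ p) (hh : 0 < h) {k : ℕ} (hk : 0 < k) :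
    |3 * ∫ y, gammaDF p y ∂(scaledGammaLaw (2 * k) (h / 2))
        - ∫ y, gammaDF p y ∂(scaledGammaLaw k h)
        - 2 * ∫ y, gammaDF p y ∂(scaledGammaLaw (4 * k) (h / 4))|
      ≤ h ^ 2 * (122 / 96) := by
  have hp0 : 0 < p := by linarith
  have t1 := tendsto_integral_gammaDF_shift hp0 (ae_nonneg_scaledGammaLaw (2 * k) (half_pos hh))
  have t2 := tendsto_integral_gammaDF_shift hp0 (ae_nonneg_scaledGammaLaw k hh)
  have t3 := tendsto_integral_gammaDF_shift hp0
    (ae_nonneg_scaledGammaLaw (4 * k) (by positivity : 0 < h / 4))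
  refine le_of_tendsto (((t1.const_mul 3).sub t2).sub (t3.const_mul 2)).abs ?_
  filter_upwards [self_mem_nhdsWithin] with ε hε
  exact abs_richardson_gammaDF_shift_le hp hh hε hk

/-! ### Convergence of dyadic refinements and summation of the steps -/

theorem abs_gammaPDFReal_le_one {p : ℝ} (hp : 2 ≤ p) (y : ℝ) : |gammaPDFReal p 1 y| ≤ 1 := by
  rw [abs_of_nonneg (gammaPDFReal_nonneg (by linarith) one_pos y), gammaPDFReal]
  split_ifs with hy
  · rcases hy.eq_or_lt with rfl | hy
    · rw [Real.zero_rpow (by linarith)]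
      simp
    · have := gammaDensity_le_one (by linarith : 1 ≤ p) hy
      rw [gammaDensity] at this
      rw [Real.one_rpow, one_mul]
      convert this using 1
      ring
  · exact zero_le_one

theorem abs_gammaDF_sub_le {p : ℝ} (hp : 2 ≤ p) (x y : ℝ) :
    |gammaDF p y - gammaDF p x| ≤ |y - x| := by
  have hp0 : 0 < p := by linarith
  have hi := integrable_gammaPDFReal hp0
  have e : gammaDF p y - gammaDF p x = ∫ z in x..y, gammaPDFReal p 1 z := by
    have h := intervalIntegral.integral_add_adjacent_intervals (a := 0) (b := x) (c := y)
      (hi.intervalIntegrable (μ := volume)) hi.intervalIntegrable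
    rw [gammaDF_eq_add_integral hp0 y, gammaDF_eq_add_integral hp0 x, ← h]
    ring
  rw [e]
  have := intervalIntegral.norm_integral_le_of_norm_le_const (a := x) (b := y) (C := 1)
    (f := gammaPDFReal p 1) fun z _ => abs_gammaPDFReal_le_one hp z
  simpa using this

theorem integral_sub_sq_gammaMeasure {q : ℝ} (hq : 0 < q) :
    ∫ y, (y - q) ^ 2 ∂(gammaMeasure q 1) = q := by
  have hG := Real.Gamma_pos_of_pos hq
  have hm : ∀ u : ℝ, 0 < u → ∫ y in Ioi 0, y ^ (u - 1) * Real.exp (-y) = Real.Gamma u := by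
    intro u hu
    rw [Real.Gamma_eq_integral hu]
    simp only [mul_comm]
  have hi : ∀ u : ℝ, 0 < u → IntegrableOn (fun y => y ^ (u - 1) * Real.exp (-y)) (Ioi 0) :=
    fun u hu => (Real.GammaIntegral_convergent hu).congr_fun (fun y _ => mul_comm _ _)
      measurableSet_Ioi
  have hq1 : 0 < q + 1 := by linarith
  have hq2 : 0 < q + 1 + 1 := by linarith
  rw [integral_gammaMeasure hq]
  have e : ∀ y ∈ Ioi (0 : ℝ), y ^ (q - 1) * Real.exp (-y) / Real.Gamma q * (y - q) ^ 2
      = (y ^ (q + 1 + 1 - 1) * Real.exp (-y) - 2 * q * (y ^ (q + 1 - 1) * Real.exp (-y))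
        + q ^ 2 * (y ^ (q - 1) * Real.exp (-y))) / Real.Gamma q := by
    intro y hy
    have hy : 0 < y := hy
    rw [add_sub_cancel_right, add_sub_cancel_right, Real.rpow_add_one hy.ne',
      Real.rpow_sub_one hy.ne']
    field_simp
    ring
  have i1 := hi _ hq2
  have i2 := (hi _ hq1).const_mul (2 * q)
  have i3 := (hi _ hq).const_mul (q ^ 2)
  have i12 : IntegrableOn (fun y => y ^ (q + 1 + 1 - 1) * Real.exp (-y)
      - 2 * q * (y ^ (q + 1 - 1) * Real.exp (-y))) (Ioi 0) := i1.sub i2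
  rw [setIntegral_congr_fun measurableSet_Ioi e, integral_div, integral_add i12 i3,
    integral_sub i1 i2, integral_const_mul, integral_const_mul, hm _ hq2, hm _ hq1, hm _ hq,
    Real.Gamma_add_one hq1.ne', Real.Gamma_add_one hq.ne']
  field_simp
  ring

theorem abs_integral_gammaDF_sub_le {p a : ℝ} (hp : 2 ≤ p) (ha : 0 < a) {n : ℕ} (hn : 0 < n) :
    |∫ y, gammaDF p y ∂(scaledGammaLaw n a) - gammaDF p (a * n)| ≤ √(a ^ 2 * n) := by
  have hn' : (0 : ℝ) < n := by exact_mod_cast hn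
  have hc := continuous_gammaDF (p := p) (by linarith)
  rw [integral_scaledGammaLaw n ha, gammaProcessLaw, if_pos hn']
  have := isProbabilityMeasure_gammaMeasure hn' one_pos
  have hv := integral_sub_sq_gammaMeasure hn'
  -- A non-integrable function would have integral `0` by convention, whereas the variance is `n >
  -- 0`.
  have hvi : Integrable (fun y => (y - (n : ℝ)) ^ 2) (gammaMeasure n 1) := by
    by_contra h
    rw [integral_undef h] at hv
    linarith
  have hFi : Integrable (fun y => gammaDF p (a * y)) (gammaMeasure n 1) :=
    integrable_of_continuous_bounded (hc.comp (by fun_prop)) (fun y => abs_gammaDF_le_one _ _) _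
  obtain ⟨δ, hδ⟩ : ∃ δ, δ = √(a ^ 2 * n) := ⟨_, rfl⟩
  have hδ0 : 0 < δ := hδ ▸ Real.sqrt_pos.2 (by positivity)
  have hδ2 : δ ^ 2 = a ^ 2 * n := hδ ▸ Real.sq_sqrt (by positivity)
  -- The Lipschitz bound followed by `|d| ≤ δ/2 + d²/(2δ)`, with `δ` the standard deviation of the
  -- scaled law.
  have hpt : ∀ y : ℝ, |gammaDF p (a * y) - gammaDF p (a * n)|
      ≤ δ / 2 + a ^ 2 / (2 * δ) * (y - n) ^ 2 := by
    intro y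
    refine (abs_gammaDF_sub_le hp _ _).trans ?_
    have e : δ / 2 + a ^ 2 / (2 * δ) * (y - n) ^ 2 - |a * y - a * n|
        = (δ - |a * y - a * n|) ^ 2 / (2 * δ) := by
      have h2 := sq_abs (a * y - a * n)
      generalize |a * y - a * n| = b at h2 ⊢
      field_simp
      linear_combination -h2
    have : 0 ≤ (δ - |a * y - a * n|) ^ 2 / (2 * δ) := by positivity
    linarith
  have hri : Integrable (fun y => δ / 2 + a ^ 2 / (2 * δ) * (y - n) ^ 2) (gammaMeasure n 1) :=
    (integrable_const _).add (hvi.const_mul _)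
  have e1 : ∫ y, gammaDF p (a * y) ∂(gammaMeasure n 1) - gammaDF p (a * n)
      = ∫ y, (gammaDF p (a * y) - gammaDF p (a * n)) ∂(gammaMeasure n 1) := by
    rw [integral_sub hFi (integrable_const _)]
    simp
  rw [e1, ← hδ]
  calc |∫ y, (gammaDF p (a * y) - gammaDF p (a * n)) ∂(gammaMeasure n 1)|
      ≤ ∫ y, |gammaDF p (a * y) - gammaDF p (a * n)| ∂(gammaMeasure n 1) :=
        abs_integral_le_integral_abs
    _ ≤ ∫ y, (δ / 2 + a ^ 2 / (2 * δ) * (y - n) ^ 2) ∂(gammaMeasure n 1) :=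
        integral_mono (hFi.sub (integrable_const _)).abs hri hpt
    _ = δ := by
        rw [integral_add (integrable_const _) (hvi.const_mul _), integral_const_mul, hv]
        simp only [integral_const, probReal_univ, one_smul]
        field_simp
        linarith

theorem abs_extrapolation_gammaDF_sub_le {p h : ℝ} (hp : 2 ≤ p) (hh : 0 < h) {k : ℕ} (hk : 0 < k) :
    |2 * ∫ y, gammaDF p y ∂(scaledGammaLaw (2 * k) (h / 2))
        - ∫ y, gammaDF p y ∂(scaledGammaLaw k h) - gammaDF p (h * k)|
      ≤ h ^ 2 * (122 / 72) := by
  obtain ⟨E, hE⟩ : ∃ E : ℕ → ℝ, E = fun N =>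
    ∫ y, gammaDF p y ∂(scaledGammaLaw (2 ^ N * k) (h / 2 ^ N)) := ⟨_, rfl⟩
  have hlim : Tendsto E atTop (𝓝 (gammaDF p (h * k))) := by
    rw [tendsto_iff_norm_sub_tendsto_zero]
    have h1 : Tendsto (fun N : ℕ => √(h ^ 2 * k * (1 / 2) ^ N)) atTop (𝓝 0) := by
      have h2 : Tendsto (fun N : ℕ => h ^ 2 * k * (1 / 2 : ℝ) ^ N) atTop (𝓝 0) := by
        simpa using (tendsto_pow_atTop_nhds_zero_of_lt_one (by norm_num : (0 : ℝ) ≤ 1 / 2)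
          (by norm_num)).const_mul (h ^ 2 * (k : ℝ))
      simpa using h2.sqrt
    refine squeeze_zero (fun _ => norm_nonneg _) (fun N => ?_) h1
    have hb := abs_integral_gammaDF_sub_le hp (by positivity : 0 < h / 2 ^ N)
      (by positivity : 0 < 2 ^ N * k)
    have e1 : h / 2 ^ N * ((2 ^ N * k : ℕ) : ℝ) = h * k := by
      push_cast
      field_simp
    have e2 : (h / 2 ^ N) ^ 2 * ((2 ^ N * k : ℕ) : ℝ) = h ^ 2 * k * (1 / 2) ^ N := by
      push_cast
      rw [one_div, inv_pow]
      field_simp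
    rw [e1, e2] at hb
    rw [hE]
    exact hb
  have hstep : ∀ N, |3 * E (N + 1) - E N - 2 * E (N + 2)|
      ≤ h ^ 2 * (122 / 96) * (1 / 4) ^ N := by
    intro N
    have hb := abs_richardson_gammaDF_le hp (by positivity : 0 < h / 2 ^ N)
      (by positivity : 0 < 2 ^ N * k)
    rw [show 2 * (2 ^ N * k) = 2 ^ (N + 1) * k by ring,
      show 4 * (2 ^ N * k) = 2 ^ (N + 2) * k by ring,
      show h / 2 ^ N / 2 = h / 2 ^ (N + 1) by rw [div_div, pow_succ],
      show h / 2 ^ N / 4 = h / 2 ^ (N + 2) by rw [div_div, pow_add]; norm_num] at hb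
    rw [hE]
    refine hb.trans_eq ?_
    rw [div_pow, ← pow_mul, mul_comm N 2, pow_mul, one_div (4 : ℝ), inv_pow]
    norm_num
    ring
  -- Telescoping with ratio `1/4`; `122/72 = (4/3)(122/96)`.
  have hsum : ∀ N, |(2 * E 1 - E 0) - (2 * E (N + 1) - E N)|
      ≤ h ^ 2 * (122 / 72) * (1 - (1 / 4) ^ N) := by
    intro N
    induction N with
    | zero => simp
    | succ N ih =>
      have h1 := abs_add_le ((2 * E 1 - E 0) - (2 * E (N + 1) - E N))
        (3 * E (N + 1) - E N - 2 * E (N + 2))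
      rw [show (2 * E 1 - E 0) - (2 * E (N + 1) - E N) + (3 * E (N + 1) - E N - 2 * E (N + 2))
        = (2 * E 1 - E 0) - (2 * E (N + 1 + 1) - E (N + 1)) by ring] at h1
      have h2 := hstep N
      rw [pow_succ (1 / 4 : ℝ)]
      linarith
  have ht : Tendsto (fun N => |(2 * E 1 - E 0) - (2 * E (N + 1) - E N)|) atTop
      (𝓝 |(2 * E 1 - E 0) - (2 * gammaDF p (h * k) - gammaDF p (h * k))|) :=
    (tendsto_const_nhds.sub (((hlim.comp (tendsto_add_atTop_nat 1)).const_mul 2).sub hlim)).abs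
  have hfin := le_of_tendsto' ht fun N => (hsum N).trans
    (mul_le_of_le_one_right (by positivity) (by
      have : (0 : ℝ) ≤ (1 / 4) ^ N := by positivity
      linarith))
  rw [hE] at hfin
  simp only [pow_one, pow_zero, one_mul, div_one] at hfin
  rwa [show ∀ c : ℝ, 2 * c - c = c by intro c; ring] at hfin

/-! ### The operators at the nodes and linear interpolation -/

theorem gammaOp_natCast_div {t s : ℝ} (ht : 0 < t) (g : ℝ → ℝ) {n k : ℕ}
    (hn : t * (k / s) = n) :
    gammaOp t g (k / s) = ∫ y, g y ∂(scaledGammaLaw n (1 / t)) := by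
  rw [gammaOp, hn, integral_scaledGammaLaw n (by positivity)]
  simp only [one_div_mul_eq_div]

theorem abs_gammaOp2_gammaDF_sub_le {p t : ℝ} (hp : 2 ≤ p) (ht : 0 < t) (k : ℕ) :
    |gammaOp2 t (gammaDF p) (k / t) - gammaDF p (k / t)| ≤ 122 / 72 / t ^ 2 := by
  rcases Nat.eq_zero_or_pos k with rfl | hk
  -- At the node `0` all laws are point masses at `0`, and the extrapolation is exact.
  · have : gammaOp2 t (gammaDF p) ((0 : ℕ) / t) - gammaDF p ((0 : ℕ) / t) = 0 := by
      simp [gammaOp2, gammaOp, gammaProcessLaw]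
      ring
    rw [this, abs_zero]
    positivity
  · rw [gammaOp2, gammaOp_natCast_div (n := 2 * k) (by positivity) _
      (by push_cast; field_simp), gammaOp_natCast_div (n := k) ht _ (by field_simp)]
    have hb := abs_extrapolation_gammaDF_sub_le hp (one_div_pos.2 ht) hk
    rw [show 1 / t / 2 = 1 / (2 * t) by field_simp, show 1 / t * k = k / t by ring] at hb
    refine hb.trans_eq ?_
    field_simp

theorem abs_linear_interpolation_gammaDF_sub_le {p t x : ℝ} (hp : 2 ≤ p) (ht : 0 < t) {k : ℕ}
    (hk : k ≤ t * x) (hk' : t * x < k + 1) :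
    |(t * x - k) * gammaDF p ((k + 1) / t) + (k + 1 - t * x) * gammaDF p (k / t) - gammaDF p x|
      ≤ 1 / 4 / t ^ 2 := by
  obtain ⟨q, rfl⟩ : ∃ q, p = q + 1 := ⟨p - 1, by ring⟩
  have hq : 1 ≤ q := by linarith
  have hc := continuous_gammaDF (p := q + 1) (by linarith)
  have hk0 : (0 : ℝ) ≤ k / t := by positivity
  rcases hk.eq_or_lt with hkx | hkx
  · have hx : x = k / t := by rw [hkx]; field_simp
    rw [← hkx, ← hx, sub_self, zero_mul, zero_add, show (k : ℝ) + 1 - k = 1 by ring, one_mul,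
      sub_self, abs_zero]
    positivity
  have hax : k / t < x := by rw [div_lt_iff₀ ht]; linarith
  have hxb : x < (k + 1) / t := by rw [lt_div_iff₀ ht]; linarith
  have hd : ∀ y, 0 < y → HasDerivAt (gammaDF (q + 1)) (gammaDensity (q + 1) y) y :=
    fun y hy => hasDerivAt_gammaDF (by linarith) hy
  -- With `λ = tx - k`, mean values on each side of `x` turn the error into `λ(1-λ)(F'(ζ) -
  -- F'(ξ))/t`. Here `ζ - ξ ≤ 1/t`, `|F''| ≤ 1` and `λ(1-λ) ≤ 1/4`.
  obtain ⟨ξ, hξ, eξ⟩ := exists_hasDerivAt_eq_slope (gammaDF (q + 1)) (gammaDensity (q + 1)) hax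
    hc.continuousOn fun y hy => hd y (hk0.trans_lt hy.1)
  obtain ⟨ζ, hζ, eζ⟩ := exists_hasDerivAt_eq_slope (gammaDF (q + 1)) (gammaDensity (q + 1)) hxb
    hc.continuousOn fun y hy => hd y ((hk0.trans_lt hax).trans hy.1)
  have hξ0 : 0 < ξ := hk0.trans_lt hξ.1
  have hξζ : ξ < ζ := hξ.2.trans hζ.1
  obtain ⟨η, hη, eη⟩ := exists_hasDerivAt_eq_slope (gammaDensity (q + 1))
    (fun y => gammaDensity q y / q * (q - y)) hξζ
    (fun y hy => (hasDerivAt_gammaDensity_add_one (by linarith)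
      (hξ0.trans_le hy.1)).continuousAt.continuousWithinAt)
    (fun y hy => hasDerivAt_gammaDensity_add_one (by linarith) (hξ0.trans hy.1))
  have hη1 := abs_gammaDensity_mul_sub_le hq (hξ0.trans hη.1)
  have hdiff : |gammaDensity (q + 1) ζ - gammaDensity (q + 1) ξ| ≤ 1 / t := by
    have hne : 0 < ζ - ξ := by linarith
    rw [eη, abs_div, abs_of_pos hne, div_le_one hne] at hη1
    have e : (k + 1) / t = k / t + 1 / t := by ring
    linarith [hζ.2, hξ.1]
  have hxa : 0 < x - k / t := by linarith
  have hbx : 0 < (k + 1) / t - x := by linarith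
  rw [eq_div_iff hxa.ne'] at eξ
  rw [eq_div_iff hbx.ne'] at eζ
  have hx1 : x - k / t = (t * x - k) / t := by field_simp
  have hx2 : (k + 1) / t - x = (k + 1 - t * x) / t := by field_simp
  rw [hx1] at eξ
  rw [hx2] at eζ
  have e : (t * x - k) * gammaDF (q + 1) ((k + 1) / t)
      + (k + 1 - t * x) * gammaDF (q + 1) (k / t) - gammaDF (q + 1) x
      = (t * x - k) * (k + 1 - t * x) * ((gammaDensity (q + 1) ζ - gammaDensity (q + 1) ξ) / t) := by
    linear_combination (-(t * x - k)) * eζ + (k + 1 - t * x) * eξ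
  have hl0 : 0 ≤ t * x - k := by linarith
  have hl1 : 0 ≤ k + 1 - t * x := by linarith
  rw [e, abs_mul, abs_of_nonneg (mul_nonneg hl0 hl1), abs_div, abs_of_pos ht]
  have h4 : (t * x - k) * (k + 1 - t * x) ≤ 1 / 4 := by
    nlinarith [sq_nonneg (2 * (t * x - k) - 1)]
  calc (t * x - k) * (k + 1 - t * x) * (|gammaDensity (q + 1) ζ - gammaDensity (q + 1) ξ| / t)
      ≤ 1 / 4 * (1 / t / t) := by gcongr
    _ = 1 / 4 / t ^ 2 := by field_simp

theorem abs_gammaInterp2_gammaDF_sub_le {p t x : ℝ} (hp : 2 ≤ p) (ht : 0 < t) (hx : 0 ≤ x) :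
    |gammaInterp2 t (gammaDF p) x - gammaDF p x| ≤ (122 / 72 + 1 / 4) / t ^ 2 := by
  obtain ⟨k, hk⟩ : ∃ k : ℕ, (⌊t * x⌋ : ℝ) = k :=
    ⟨⌊t * x⌋₊, by rw [natCast_floor_eq_intCast_floor (by positivity)]⟩
  have hk1 : (k : ℝ) ≤ t * x := hk ▸ Int.floor_le _
  have hk2 : t * x < k + 1 := hk ▸ Int.lt_floor_add_one _
  have h1 := abs_gammaOp2_gammaDF_sub_le hp ht k
  have h2 := abs_gammaOp2_gammaDF_sub_le hp ht (k + 1)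
  have h3 := abs_linear_interpolation_gammaDF_sub_le hp ht hk1 hk2
  push_cast at h2
  rw [gammaInterp2, hk]
  have hl0 : 0 ≤ t * x - k := by linarith
  have hl1 : 0 ≤ k + 1 - t * x := by linarith
  have e : (t * x - k) * gammaOp2 t (gammaDF p) ((k + 1) / t)
      + (k + 1 - t * x) * gammaOp2 t (gammaDF p) (k / t) - gammaDF p x
      = (t * x - k) * (gammaOp2 t (gammaDF p) ((k + 1) / t) - gammaDF p ((k + 1) / t))
        + (k + 1 - t * x) * (gammaOp2 t (gammaDF p) (k / t) - gammaDF p (k / t))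
        + ((t * x - k) * gammaDF p ((k + 1) / t) + (k + 1 - t * x) * gammaDF p (k / t)
          - gammaDF p x) := by ring
  rw [e]
  refine (abs_add_three _ _ _).trans ?_
  rw [abs_mul, abs_mul, abs_of_nonneg hl0, abs_of_nonneg hl1]
  calc _ ≤ (t * x - k) * (122 / 72 / t ^ 2) + (k + 1 - t * x) * (122 / 72 / t ^ 2)
        + 1 / 4 / t ^ 2 := by gcongr
    _ = _ := by ring

theorem mainTheorem3 :
    (∀ p : ℝ, 2 ≤ p → ∀ t : ℝ, 0 < t →
      (∀ s : ℝ, 0 < s → ∀ x : ℝ, 0 ≤ x →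
        Integrable (fun y => gammaDF p (y / s)) (gammaProcessLaw (s * x))) ∧
      supNormNonneg (fun x => gammaInterp2 t (gammaDF p) x - gammaDF p x)
        ≤ ENNReal.ofReal ((17 / 12 + 27 / (16 * Real.exp 1)) / t ^ 2)) ∧
    |(17 / 12 + 27 / (16 * Real.exp 1)) - (2.0375 : ℝ)| ≤ 0.00005 := by
  have he1 := Real.exp_one_gt_d9
  have he2 := Real.exp_one_lt_d9
  have hlow : (62079 / 100000 : ℝ) ≤ 27 / (16 * Real.exp 1) := by
    rw [le_div_iff₀ (by positivity)]
    linarith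
  have hupp : 27 / (16 * Real.exp 1) ≤ (62080 / 100000 : ℝ) := by
    rw [div_le_iff₀ (by positivity)]
    linarith
  refine ⟨fun p hp t ht => ⟨fun s _ x _ => ?_, ?_⟩, ?_⟩
  · exact integrable_of_continuous_bounded
      ((continuous_gammaDF (by linarith)).comp (by fun_prop)) (fun y => abs_gammaDF_le_one _ _) _
  · refine iSup₂_le fun x hx => ENNReal.ofReal_le_ofReal ?_
    refine (abs_gammaInterp2_gammaDF_sub_le hp ht hx).trans ?_
    -- Numerically `122/72 + 1/4 = 35/18 < 17/12 + 0.62079`.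
    exact div_le_div_of_nonneg_right (by linarith) (by positivity)
  · rw [abs_le]
    constructor <;> linarith
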